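/- Let $n\ge 1$. Cubes $Q\subset\mathbb R^n$ are non-degenerate with sides parallel to the coordinate axes, and $|Q|$ is the Lebesgue measure of $Q$. A weight is a locally integrable function $w$ on $\mathbb R^n$ with $w>0$ almost everywhere. For $1<p<\infty$ put $1/p'=1-1/p$. * $RH_p$ is the class of weights $w$ for which there is $C>0$ such that $\left(\frac1{|Q|}\int_Q w^p\,dx\right)^{1/p}\le C\,\frac1{|Q|}\int_Q w\,dx$ for all cubes $Q$, and $RH=\bigcup_{p>1}RH_p$. * $RH_{L\log L}$ is the class of weights $w$ for which there is $C>0$ such that $\|w\|_{L\log L(Q)}\le C\,\frac1{|Q|}\int_Q w\,dx$ for all cubes $Q$, where $\|f\|_{L\log L(Q)}=\inf\left\{r>0:\frac1{|Q|}\int_Q\frac{|f|}{r}\log\left(e+\frac{|f|}{r}\right)dx\le1\right\}$ (and $\inf\emptyset=\infty$). * For a weight $w$, a cube $Q$ and $0<s<|Q|$ let $\phi_{w,Q}(s)=K(s,w\chi_Q;L^1(Q),L^\infty(Q))=\inf\{\|g\|_{L^1(Q)}+s\|h\|_{L^\infty(Q)}: w\chi_Q=g+h \text{ a.e. on } Q,\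 g\in L^1(Q),\ h\in L^\infty(Q)\}$, and for $\beta\in[0,1)$, $q\ge1$ let $\phi_{w,Q,\beta,q}(s)=\left(s^{-\beta}\phi_{w,Q}(s)\right)^q$. * A non-negative function $\psi$ on $(0,l)$ is almost increasing with constant $C\ge1$ if $\psi(s)\le C\psi(t)$ whenever $0<s\le t<l$. For a family $\{\psi_Q\}_Q$ of functions $\psi_Q$ on $(0,|Q|)$, indexed by the cubes, $\mathrm{ind}\{\psi_Q\}_Q\in[-\infty,\infty]$ is the supremum of all $\delta\ge0$ for which there are $\gamma\in(0,1)$ and $C\ge1$ such that, for every cube $Q$, the function $s\mapsto\psi_Q(s)s^{-\delta}$ is almost increasing on $(0,\gamma|Q|)$ with constant $C$ ($\sup\emptyset=-\infty$). Then: (i) for every $1<p<\infty$, $$RH_p=\{w \text{ weight}:\mathrm{ind}\{\phi_{w,Q,1/p',p}\}_Q>0\}=\{w\text{ weight}:\mathrm{ind}\{\phi_{w,Q}\}_Q>1/p'\};$$ (ii) $RH=\{w\text{ weight}:\mathrm{ind}\{\phi_{w,Q}\}_Q>0\}$; (iii) $RH=RH_{L\log L}$. -/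

import Mathlib

open MeasureTheory

noncomputable section

namespace RevHolder

/-- A non-degenerate cube in `ℝⁿ` with sides parallel to the coordinate axes, given by its
lower corner and its side length. (Only the Lebesgue measure and the topology of `ℝⁿ` are used
below, so `ℝⁿ` is modelled by `Fin n → ℝ`.) -/
structure Cube (n : ℕ) where
  corner : Fin n → ℝ
  side : ℝ
  side_pos : 0 < side

/-- The underlying (closed) set of a cube. -/
def Cube.toSet {n : ℕ} (Q : Cube n) : Set (Fin n → ℝ) :=
  Set.Icc Q.corner (fun i => Q.corner i + Q.side)

/-- The Lebesgue measure `|Q|` as a real number. -/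
def Cube.vol {n : ℕ} (Q : Cube n) : ℝ := (volume Q.toSet).toReal

/-- The average `|Q|⁻¹ ∫_Q f` of a function with values in `[0, ∞]`. -/
def Cube.avg {n : ℕ} (Q : Cube n) (f : (Fin n → ℝ) → ENNReal) : ENNReal :=
  (∫⁻ x in Q.toSet, f x) / volume Q.toSet

/-- A weight: a locally integrable function on `ℝⁿ` that is positive almost everywhere. -/
def IsWeight {n : ℕ} (w : (Fin n → ℝ) → ℝ) : Prop :=
  LocallyIntegrable w volume ∧ ∀ᵐ x ∂(volume : Measure (Fin n → ℝ)), 0 < w x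

/-- The class `RH_p`. The averages are Lebesgue integrals with values in `[0, ∞]`, so the
inequality contains the finiteness of the average of `w ^ p`. -/
def RHp (n : ℕ) (p : ℝ) : Set ((Fin n → ℝ) → ℝ) :=
  {w | IsWeight w ∧ ∃ C : ℝ, 0 < C ∧ ∀ Q : Cube n,
    (Q.avg (fun x => ENNReal.ofReal (w x ^ p))) ^ (1 / p)
      ≤ ENNReal.ofReal C * Q.avg (fun x => ENNReal.ofReal (w x))}

/-- The limiting class `RH`, the union of the classes `RH_p` over `1 < p < ∞`. -/
def RH (n : ℕ) : Set ((Fin n → ℝ) → ℝ) :=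
  ⋃ p ∈ Set.Ioi (1 : ℝ), RHp n p

/-- The Luxemburg norm of `f` in `L log L (Q, dx / |Q|)`; it is `∞` if no `r > 0` is admissible. -/
def normLLogL {n : ℕ} (f : (Fin n → ℝ) → ℝ) (Q : Cube n) : ENNReal :=
  sInf {R : ENNReal | ∃ r : ℝ, 0 < r ∧ R = ENNReal.ofReal r ∧
    Q.avg (fun x =>
      ENNReal.ofReal (|f x| / r * Real.log (Real.exp 1 + |f x| / r))) ≤ 1}

/-- The class `RH_{L log L}`. -/
def RHLLogL (n : ℕ) : Set ((Fin n → ℝ) → ℝ) :=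
  {w | IsWeight w ∧ ∃ C : ℝ, 0 < C ∧ ∀ Q : Cube n,
    normLLogL w Q ≤ ENNReal.ofReal C * Q.avg (fun x => ENNReal.ofReal (w x))}

/-- Peetre's functional `K(t, f; L¹(μ), L^∞(μ))`: the infimum of `‖g‖₁ + t ‖h‖_∞` over all
decompositions `f = g + h` (almost everywhere) with `g ∈ L¹(μ)`, `h ∈ L^∞(μ)`. -/
def KFunctional {α : Type*} [MeasurableSpace α] (μ : Measure α) (t : ℝ) (f : α → ℝ) : ℝ :=
  sInf {r : ℝ | ∃ g h : α → ℝ, MemLp g 1 μ ∧ MemLp h ⊤ μ ∧ f =ᵐ[μ] g + h ∧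
    r = (eLpNorm g 1 μ).toReal + t * (eLpNorm h ⊤ μ).toReal}

/-- `φ_{w,Q}(s) = K(s, w χ_Q; L¹(Q), L^∞(Q))`. -/
def phi {n : ℕ} (w : (Fin n → ℝ) → ℝ) (Q : Cube n) (s : ℝ) : ℝ :=
  KFunctional (volume.restrict Q.toSet) s (Q.toSet.indicator w)

/-- `φ_{w,Q,β,q}(s) = (s^{-β} φ_{w,Q}(s))^q`. -/
def phiParam {n : ℕ} (w : (Fin n → ℝ) → ℝ) (β q : ℝ) (Q : Cube n) (s : ℝ) : ℝ :=
  (s ^ (-β) * phi w Q s) ^ q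

/-- The function `ψ` is non-negative and almost increasing on `(0, l)`, with constant `C`. -/
def AlmostIncreasing (ψ : ℝ → ℝ) (l C : ℝ) : Prop :=
  1 ≤ C ∧ (∀ s ∈ Set.Ioo 0 l, 0 ≤ ψ s) ∧
    ∀ s ∈ Set.Ioo 0 l, ∀ t ∈ Set.Ioo 0 l, s ≤ t → ψ s ≤ C * ψ t

/-- The index of a family of functions `ψ_Q` on `(0, |Q|)`: the supremum, in the extended reals,
of all `δ ≥ 0` for which there is `γ ∈ (0, 1)` such that for all cubes `Q` the function
`ψ_Q(s) s^{-δ}` is almost increasing on `(0, γ |Q|)`, with a constant independent of `Q`. -/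
def ind {n : ℕ} (ψ : Cube n → ℝ → ℝ) : EReal :=
  sSup {D : EReal | ∃ δ : ℝ, 0 ≤ δ ∧ D = (δ : EReal) ∧
    ∃ γ ∈ Set.Ioo (0 : ℝ) 1, ∃ C : ℝ, ∀ Q : Cube n,
      AlmostIncreasing (fun s => ψ Q s * s ^ (-δ)) (γ * Q.vol) C}

end RevHolder

end

noncomputable section

namespace RevHolder

/-! ### Cubes and weights -/

section

variable {n : ℕ}

/-! Write φ for φ_{w,Q} and w(Q) for the integral of w over Q. Truncating w at height l gives φ(s) ≤
∫_Q (w - l)₊ + s l (`phi_le`), while φ(s) ≥ ∫_E w whenever E ⊆ Q and |E| ≤ s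
(`setIntegral_le_phi_of_le`). So φ(s) essentially measures the largest w-mass of a subset of measure
s.

From index to integrability: an index above a gives φ(s) ≤ A (s/|Q|)^δ w(Q) with some δ > a. On
superlevel sets this is, for δ < 1, a weak-type bound of exponent 1/(1-δ), which exceeds p when δ >
1 - 1/p = 1/p'. The layer-cake formula then yields RH_p (`PhiDecay.reverseHolder`).

From integrability to index: φ(s) must be compared with φ(t) for all s ≤ t, not only with w(Q). The
Calderón–Zygmund decomposition at level 2φ(t)/t yields subcubes of total measure at most t/2 off
which w is below the level; the hypothesis is applied on each of them. RH_q gives growth with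
exponent 1 - 1/q (`phiGrowth_of_reverseHolder`). The weaker property `SmallPortions` gives φ(θt) ≤ ρ
φ(t), and by iteration some positive exponent.

RH_p alone yields only an index at least 1 - 1/p; strictness is Gehring's lemma
(`ReverseHolder.exists_gt`), which the same tools prove: RH_p for w gives `SmallPortions` for w^p by
Hölder, so w^p has positive index and lies in some RH_r, and w lies in RH_{pr}. Similarly RH_{L log
L} implies `SmallPortions`, hence RH; conversely x log(e + x) is dominated by x + x^p. -/

theorem Cube.measurableSet (Q : Cube n) : MeasurableSet Q.toSet := measurableSet_Icc

theorem Cube.isCompact (Q : Cube n) : IsCompact Q.toSet := isCompact_Icc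

theorem Cube.volume_toSet (Q : Cube n) : volume Q.toSet = ENNReal.ofReal (Q.side ^ n) := by
  simp [Cube.toSet, Real.volume_Icc_pi, ENNReal.ofReal_pow Q.side_pos.le]

theorem Cube.vol_eq (Q : Cube n) : Q.vol = Q.side ^ n := by
  rw [Cube.vol, Q.volume_toSet, ENNReal.toReal_ofReal (pow_nonneg Q.side_pos.le n)]

theorem Cube.vol_pos (Q : Cube n) : 0 < Q.vol := by
  rw [Q.vol_eq]; exact pow_pos Q.side_pos n

theorem Cube.volume_eq_ofReal (Q : Cube n) : volume Q.toSet = ENNReal.ofReal Q.vol := by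
  rw [Q.vol_eq, Q.volume_toSet]

theorem Cube.volume_ne_top (Q : Cube n) : volume Q.toSet ≠ ⊤ := by
  rw [Q.volume_toSet]; exact ENNReal.ofReal_ne_top

theorem Cube.volume_ne_zero (Q : Cube n) : volume Q.toSet ≠ 0 := by
  rw [Q.volume_eq_ofReal]; simpa using Q.vol_pos

instance (Q : Cube n) : IsFiniteMeasure (volume.restrict Q.toSet) :=
  ⟨by simpa using Q.volume_ne_top.lt_top⟩

theorem Cube.vol_eq_real (Q : Cube n) : Q.vol = volume.real Q.toSet := rfl

theorem Cube.measureReal_le_vol {Q : Cube n} {E : Set (Fin n → ℝ)} (h : E ⊆ Q.toSet) :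
    volume.real E ≤ Q.vol :=
  measureReal_mono h Q.volume_ne_top

section Weight

variable {w : (Fin n → ℝ) → ℝ}

theorem IsWeight.integrableOn (hw : IsWeight w) (Q : Cube n) : IntegrableOn w Q.toSet :=
  hw.1.integrableOn_isCompact Q.isCompact

theorem IsWeight.ae_pos (hw : IsWeight w) (E : Set (Fin n → ℝ)) :
    ∀ᵐ x ∂(volume.restrict E), 0 < w x :=
  ae_restrict_of_ae hw.2

theorem IsWeight.ae_nonneg (hw : IsWeight w) (E : Set (Fin n → ℝ)) :
    0 ≤ᵐ[volume.restrict E] w :=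
  (hw.ae_pos E).mono fun _ hx => hx.le

theorem IsWeight.setIntegral_nonneg (hw : IsWeight w) (E : Set (Fin n → ℝ)) :
    0 ≤ ∫ x in E, w x :=
  integral_nonneg_of_ae (hw.ae_nonneg E)

theorem IsWeight.setIntegral_mono (hw : IsWeight w) {Q : Cube n} {E F : Set (Fin n → ℝ)}
    (hEF : E ⊆ F) (hF : F ⊆ Q.toSet) : ∫ x in E, w x ≤ ∫ x in F, w x :=
  setIntegral_mono_set ((hw.integrableOn Q).mono_set hF) (hw.ae_nonneg F)
    (Filter.Eventually.of_forall hEF)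

theorem IsWeight.setIntegral_pos (hw : IsWeight w) (Q : Cube n) : 0 < ∫ x in Q.toSet, w x := by
  rw [setIntegral_pos_iff_support_of_nonneg_ae (hw.ae_nonneg _) (hw.integrableOn Q)]
  have h : (Function.support w ∩ Q.toSet : Set _) =ᵐ[volume] Q.toSet := by
    filter_upwards [hw.2] with x hx
    have hs : Function.support w x := hx.ne'
    exact propext ⟨fun h => h.2, fun h => ⟨hs, h⟩⟩
  rw [measure_congr h]
  exact pos_iff_ne_zero.2 Q.volume_ne_zero

theorem Cube.avg_ofReal {f : (Fin n → ℝ) → ℝ} {Q : Cube n} (hf : IntegrableOn f Q.toSet)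
    (h0 : 0 ≤ᵐ[volume.restrict Q.toSet] f) :
    Q.avg (fun x => ENNReal.ofReal (f x)) = ENNReal.ofReal ((∫ x in Q.toSet, f x) / Q.vol) := by
  rw [Cube.avg, ← ofReal_integral_eq_lintegral_ofReal hf h0, Q.volume_eq_ofReal,
    ENNReal.ofReal_div_of_pos Q.vol_pos]

theorem IsWeight.avg_eq (hw : IsWeight w) (Q : Cube n) :
    Q.avg (fun x => ENNReal.ofReal (w x)) = ENNReal.ofReal ((∫ x in Q.toSet, w x) / Q.vol) :=
  Cube.avg_ofReal (hw.integrableOn Q) (hw.ae_nonneg _)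

theorem IsWeight.exists_measurable (hw : IsWeight w) :
    ∃ w₀ : (Fin n → ℝ) → ℝ, Measurable w₀ ∧ w =ᵐ[volume] w₀ :=
  ⟨_, hw.1.aestronglyMeasurable.stronglyMeasurable_mk.measurable,
    hw.1.aestronglyMeasurable.ae_eq_mk⟩

end Weight

/-! ### Upper and lower bounds for the K-functional -/

section KFunctional

variable {w : (Fin n → ℝ) → ℝ} {Q : Cube n} {s t : ℝ}

/-- The set whose infimum is `φ_{w,Q}(s)`. -/
def phiSet (w : (Fin n → ℝ) → ℝ) (Q : Cube n) (s : ℝ) : Set ℝ :=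
  {r : ℝ | ∃ g h : (Fin n → ℝ) → ℝ, MemLp g 1 (volume.restrict Q.toSet) ∧
    MemLp h ⊤ (volume.restrict Q.toSet) ∧ Q.toSet.indicator w =ᵐ[volume.restrict Q.toSet] g + h ∧
    r = (eLpNorm g 1 (volume.restrict Q.toSet)).toReal
      + s * (eLpNorm h ⊤ (volume.restrict Q.toSet)).toReal}

theorem bddBelow_phiSet (hs : 0 ≤ s) : BddBelow (phiSet w Q s) := by
  refine ⟨0, ?_⟩
  rintro r ⟨g, h, -, -, -, rfl⟩
  positivity

theorem indicator_toSet_ae_eq : Q.toSet.indicator w =ᵐ[volume.restrict Q.toSet] w :=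
  indicator_ae_eq_restrict Q.measurableSet

/-- Truncation is the competitor: g = (w - l)₊ and h = min(w, l). -/
theorem phi_le (hw : IsWeight w) (Q : Cube n) (hs : 0 ≤ s) {l : ℝ} (hl : 0 ≤ l) :
    phi w Q s ≤ (∫ x in Q.toSet, max (w x - l) 0) + s * l := by
  have hi := hw.integrableOn Q
  have hg : Integrable (fun x => max (w x - l) 0) (volume.restrict Q.toSet) :=
    (hi.sub (integrable_const l)).pos_part
  have hh : AEStronglyMeasurable (fun x => min (w x) l) (volume.restrict Q.toSet) :=
    hi.aestronglyMeasurable.inf aestronglyMeasurable_const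
  have hb : ∀ᵐ x ∂(volume.restrict Q.toSet), ‖min (w x) l‖ ≤ l := by
    filter_upwards [hw.ae_pos Q.toSet] with x hx
    rw [Real.norm_eq_abs, abs_of_nonneg (le_min hx.le hl)]
    exact min_le_right _ _
  have hle : (eLpNorm (fun x => min (w x) l) ⊤ (volume.restrict Q.toSet)).toReal ≤ l := by
    refine ENNReal.toReal_le_of_le_ofReal hl ?_
    rw [eLpNorm_exponent_top]
    exact eLpNormEssSup_le_of_ae_bound hb
  have hmem : (eLpNorm (fun x => max (w x - l) 0) 1 (volume.restrict Q.toSet)).toReal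
      + s * (eLpNorm (fun x => min (w x) l) ⊤ (volume.restrict Q.toSet)).toReal ∈ phiSet w Q s := by
    refine ⟨_, _, memLp_one_iff_integrable.2 hg, memLp_top_of_bound hh l hb, ?_, rfl⟩
    filter_upwards [indicator_toSet_ae_eq (w := w) (Q := Q)] with x hx
    rw [hx, Pi.add_apply]
    rcases le_total (w x) l with h | h
    · rw [min_eq_left h, max_eq_right (by linarith), zero_add]
    · rw [min_eq_right h, max_eq_left (by linarith), sub_add_cancel]
  refine (csInf_le (bddBelow_phiSet hs) hmem).trans ?_
  refine add_le_add (le_of_eq ?_) (mul_le_mul_of_nonneg_left hle hs)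
  rw [eLpNorm_one_eq_lintegral_enorm, ← integral_norm_eq_lintegral_enorm hg.aestronglyMeasurable]
  refine integral_congr_ae (Filter.Eventually.of_forall fun x => ?_)
  exact Real.norm_of_nonneg (le_max_right _ _)

theorem phiSet_nonempty (hw : IsWeight w) (Q : Cube n) (s : ℝ) : (phiSet w Q s).Nonempty := by
  refine ⟨_, w, 0, memLp_one_iff_integrable.2 (hw.integrableOn Q), MemLp.zero, ?_, rfl⟩
  rw [add_zero]
  exact indicator_toSet_ae_eq

theorem phi_nonneg (hs : 0 ≤ s) : 0 ≤ phi w Q s := by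
  refine Real.sInf_nonneg ?_
  rintro r ⟨g, h, -, -, -, rfl⟩
  positivity

theorem phi_mono (hw : IsWeight w) (hs : 0 ≤ s) (hst : s ≤ t) : phi w Q s ≤ phi w Q t := by
  refine le_csInf (phiSet_nonempty hw Q t) ?_
  rintro r ⟨g, h, hg, hh, he, rfl⟩
  refine (csInf_le (bddBelow_phiSet hs) ⟨g, h, hg, hh, he, rfl⟩).trans ?_
  gcongr

theorem phi_le_integral (hw : IsWeight w) (hs : 0 ≤ s) : phi w Q s ≤ ∫ x in Q.toSet, w x := by
  refine (phi_le hw Q hs le_rfl).trans (le_of_eq ?_)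
  rw [mul_zero, add_zero]
  refine integral_congr_ae ?_
  filter_upwards [hw.ae_pos Q.toSet] with x hx
  rw [sub_zero, max_eq_left hx.le]

/-- Every decomposition w = g + h satisfies ∫_E w ≤ ‖g‖₁ + |E| ‖h‖_∞, and the maximum is the factor
that makes ‖g‖₁ + s ‖h‖_∞ dominate this. -/
theorem setIntegral_le_phi (hw : IsWeight w) {E : Set (Fin n → ℝ)}
    (hEQ : E ⊆ Q.toSet) (hs : 0 < s) :
    ∫ x in E, w x ≤ max 1 (volume.real E / s) * phi w Q s := by
  have hM : 0 < max 1 (volume.real E / s) := lt_max_of_lt_left one_pos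
  rw [← div_le_iff₀' hM]
  refine le_csInf (phiSet_nonempty hw Q s) ?_
  rintro r ⟨g, h, hg, hh, he, rfl⟩
  rw [div_le_iff₀' hM]
  have hr : volume.restrict E ≤ volume.restrict Q.toSet := Measure.restrict_mono_set _ hEQ
  have hgi : Integrable g (volume.restrict Q.toSet) := memLp_one_iff_integrable.1 hg
  have hfin : IsFiniteMeasure (volume.restrict E) := isFiniteMeasure_of_le _ hr
  set G := (eLpNorm g 1 (volume.restrict Q.toSet)).toReal with hG
  set H := (eLpNorm h ⊤ (volume.restrict Q.toSet)).toReal with hH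
  have hGe : G = ∫ x in Q.toSet, ‖g x‖ := by
    rw [integral_norm_eq_lintegral_enorm hgi.aestronglyMeasurable, hG,
      eLpNorm_one_eq_lintegral_enorm]
  have hHb : ∀ᵐ x ∂(volume.restrict Q.toSet), ‖h x‖ ≤ H := by
    filter_upwards [ae_le_eLpNormEssSup (f := h) (μ := volume.restrict Q.toSet)] with x hx
    rw [← eLpNorm_exponent_top] at hx
    have := ENNReal.toReal_mono hh.2.ne hx
    rwa [toReal_enorm] at this
  have hH0 : 0 ≤ H := ENNReal.toReal_nonneg
  have hG0 : 0 ≤ G := ENNReal.toReal_nonneg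
  have h1 : ∫ x in E, w x ≤ ∫ x in E, (‖g x‖ + H) := by
    refine integral_mono_ae ((hw.integrableOn Q).mono_set hEQ)
      ((hgi.norm.mono_measure hr).add (integrable_const H)) ?_
    refine ae_mono hr ?_
    filter_upwards [hHb, he, indicator_toSet_ae_eq (w := w) (Q := Q)] with x h1 h2 h3
    rw [← h3, h2, Pi.add_apply]
    exact add_le_add (Real.le_norm_self _) ((Real.le_norm_self _).trans h1)
  have h2 : ∫ x in E, (‖g x‖ + H) ≤ G + volume.real E * H := by
    rw [integral_add (hgi.norm.mono_measure hr) (integrable_const H), setIntegral_const,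
      smul_eq_mul, hGe]
    exact add_le_add_left (setIntegral_mono_set hgi.norm
      (Filter.Eventually.of_forall fun x => norm_nonneg _) hEQ.eventuallyLE) _
  refine h1.trans (h2.trans ?_)
  rw [mul_add, ← mul_assoc]
  refine add_le_add (le_mul_of_one_le_left hG0 (le_max_left _ _)) ?_
  refine mul_le_mul_of_nonneg_right ?_ hH0
  rw [← div_le_iff₀ hs]
  exact le_max_right _ _

theorem setIntegral_le_phi_of_le (hw : IsWeight w) {E : Set (Fin n → ℝ)}
    (hEQ : E ⊆ Q.toSet) (hs : 0 < s) (hEs : volume.real E ≤ s) :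
    ∫ x in E, w x ≤ phi w Q s := by
  have h := setIntegral_le_phi hw hEQ hs
  rwa [max_eq_left ((div_le_one hs).2 hEs), one_mul] at h

theorem mul_integral_le_phi (hw : IsWeight w) (hs : 0 < s) (hsQ : s ≤ Q.vol) :
    s / Q.vol * ∫ x in Q.toSet, w x ≤ phi w Q s := by
  have h := setIntegral_le_phi hw (subset_refl Q.toSet) hs
  rw [← Cube.vol_eq_real, max_eq_right ((one_le_div hs).2 hsQ)] at h
  have hQ := Q.vol_pos
  calc s / Q.vol * ∫ x in Q.toSet, w x ≤ s / Q.vol * (Q.vol / s * phi w Q s) := by gcongr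
    _ = phi w Q s := by field_simp

theorem phi_pos (hw : IsWeight w) (hs : 0 < s) (hsQ : s ≤ Q.vol) : 0 < phi w Q s :=
  (mul_pos (div_pos hs Q.vol_pos) (hw.setIntegral_pos Q)).trans_le (mul_integral_le_phi hw hs hsQ)

/-- Chebyshev's inequality in terms of `φ_{w,Q}`: a subset of `Q` on which `w` has average above
`K φ(t) / t`, `K > 1`, has measure at most `t / K`. -/
theorem measureReal_le_of_phi_le (hw : IsWeight w) {E : Set (Fin n → ℝ)} (hEQ : E ⊆ Q.toSet)
    (ht : 0 < t) (htQ : t ≤ Q.vol) {K : ℝ} (hK : 1 < K)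
    (hE : K * phi w Q t / t * volume.real E ≤ ∫ x in E, w x) : volume.real E ≤ t / K := by
  have hp := phi_pos hw ht htQ
  have h := hE.trans (setIntegral_le_phi hw hEQ ht)
  -- With x = |E|/t this reads K x ≤ max(1, x); as K > 1, x ≥ 1 is impossible.
  have h' : K * (volume.real E / t) ≤ max 1 (volume.real E / t) := by
    refine le_of_mul_le_mul_right ?_ hp
    calc _ = K * phi w Q t / t * volume.real E := by ring
      _ ≤ _ := h
  have h0 : 0 ≤ volume.real E / t := div_nonneg measureReal_nonneg ht.le
  rw [le_div_iff₀ (by linarith)]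
  rcases le_total (volume.real E / t) 1 with h1 | h1
  · rw [max_eq_left h1] at h'
    have := mul_le_mul_of_nonneg_right h' ht.le
    calc volume.real E * K = K * (volume.real E / t) * t := by field_simp
      _ ≤ _ := by linarith
  · rw [max_eq_right h1] at h'
    nlinarith

end KFunctional

end

section

variable {n : ℕ}

/-! ### Dyadic subcubes and the Calderón–Zygmund decomposition -/

section Dyadic

/-- The dyadic subcube of `Q` of generation `k` with index `j`. -/
def Cube.dyadic (Q : Cube n) (k : ℕ) (j : Fin n → ℤ) : Cube n where
  corner i := Q.corner i + j i * (Q.side / 2 ^ k)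
  side := Q.side / 2 ^ k
  side_pos := div_pos Q.side_pos (by positivity)

/-- The half-open dyadic subcube of `Q` of generation `k` with index `j`. -/
def Cube.dyadicIco (Q : Cube n) (k : ℕ) (j : Fin n → ℤ) : Set (Fin n → ℝ) :=
  Set.univ.pi fun i => Set.Ico ((Q.dyadic k j).corner i)
    ((Q.dyadic k j).corner i + (Q.dyadic k j).side)

/-- The index of the dyadic subcube of generation `k` containing `x`. -/
def Cube.dyadicIndex (Q : Cube n) (k : ℕ) (x : Fin n → ℝ) (i : Fin n) : ℤ :=
  ⌊(x i - Q.corner i) / (Q.side / 2 ^ k)⌋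

variable (Q : Cube n) {k l : ℕ} {j : Fin n → ℤ} {x y : Fin n → ℝ}

theorem Cube.dyadicIco_ae_eq (k : ℕ) (j : Fin n → ℤ) :
    Q.dyadicIco k j =ᵐ[volume] (Q.dyadic k j).toSet :=
  Measure.univ_pi_Ico_ae_eq_Icc

theorem Cube.dyadicIco_subset : Q.dyadicIco k j ⊆ (Q.dyadic k j).toSet := by
  intro x hx
  exact ⟨fun i => (hx i trivial).1, fun i => (hx i trivial).2.le⟩

theorem Cube.mem_dyadicIco : x ∈ Q.dyadicIco k j ↔ Q.dyadicIndex k x = j := by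
  have h : 0 < Q.side / 2 ^ k := div_pos Q.side_pos (by positivity)
  rw [funext_iff]
  simp only [dyadicIco, dyadicIndex, dyadic, Set.mem_pi, Set.mem_univ, true_imp_iff, Set.mem_Ico,
    Int.floor_eq_iff]
  refine forall_congr' fun i => and_congr ?_ ?_
  · rw [le_div_iff₀ h]
    constructor <;> intro h <;> linarith
  · rw [div_lt_iff₀ h]
    constructor <;> intro h <;> linarith

/-- Integer division by 2 passes to the parent; this encodes the nesting of dyadic cubes. -/
theorem Cube.dyadicIndex_succ (k : ℕ) (x : Fin n → ℝ) (i : Fin n) :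
    Q.dyadicIndex k x i = Q.dyadicIndex (k + 1) x i / 2 := by
  have h : (x i - Q.corner i) / (Q.side / 2 ^ k)
      = (x i - Q.corner i) / (Q.side / 2 ^ (k + 1)) / 2 := by
    have := Q.side_pos
    field_simp
    ring
  rw [dyadicIndex, h, dyadicIndex]
  exact_mod_cast Int.floor_div_natCast _ 2

theorem Cube.dyadicIndex_eq_of_le (hkl : k ≤ l) (h : Q.dyadicIndex l x = Q.dyadicIndex l y) :
    Q.dyadicIndex k x = Q.dyadicIndex k y := by
  induction l, hkl using Nat.le_induction with
  | base => exact h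
  | succ m hm ih =>
    refine ih (funext fun i => ?_)
    rw [Q.dyadicIndex_succ m x, Q.dyadicIndex_succ m y, h]

theorem Cube.dyadicIco_zero_ae_eq : Q.dyadicIco 0 0 =ᵐ[volume] Q.toSet := by
  have h := Q.dyadicIco_ae_eq 0 0
  have e : (Q.dyadic 0 0).toSet = Q.toSet := by simp [Cube.dyadic, Cube.toSet]
  rwa [e] at h

theorem Cube.dyadicIndex_bounds (hx : x ∈ Q.dyadicIco 0 0) (k : ℕ) (i : Fin n) :
    0 ≤ Q.dyadicIndex k x i ∧ Q.dyadicIndex k x i < 2 ^ k := by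
  have hx' := (hx i trivial)
  have hs := Q.side_pos
  simp only [dyadic, Set.mem_Ico, pow_zero, div_one, Pi.zero_apply, Int.cast_zero, zero_mul,
    add_zero] at hx'
  constructor
  · exact Int.floor_nonneg.2 (div_nonneg (by linarith) (by positivity))
  · refine Int.floor_lt.2 ?_
    push_cast
    rw [div_lt_iff₀ (by positivity), mul_div_cancel₀ _ (by positivity)]
    linarith

theorem Cube.dyadic_subset (hx : x ∈ Q.dyadicIco 0 0) (k : ℕ) :
    (Q.dyadic k (Q.dyadicIndex k x)).toSet ⊆ Q.toSet := by
  intro y hy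
  refine ⟨fun i => le_trans ?_ (hy.1 i), fun i => (hy.2 i).trans ?_⟩ <;>
    obtain ⟨h0, h1⟩ := Q.dyadicIndex_bounds hx k i <;>
    have hs : 0 < Q.side / 2 ^ k := div_pos Q.side_pos (by positivity)
  · have : (0 : ℝ) ≤ Q.dyadicIndex k x i := by exact_mod_cast h0
    simp only [dyadic]
    have := mul_nonneg this hs.le
    linarith
  · have : (Q.dyadicIndex k x i : ℝ) + 1 ≤ 2 ^ k := by exact_mod_cast h1
    simp only [dyadic]
    have h2 := mul_le_mul_of_nonneg_right this hs.le
    rw [mul_div_cancel₀ _ (by positivity)] at h2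
    linarith

theorem Cube.dyadic_succ_subset (k : ℕ) (x : Fin n → ℝ) :
    (Q.dyadic (k + 1) (Q.dyadicIndex (k + 1) x)).toSet ⊆
      (Q.dyadic k (Q.dyadicIndex k x)).toSet := by
  intro y hy
  have hs : 0 < Q.side / 2 ^ (k + 1) := div_pos Q.side_pos (by positivity)
  have he : Q.side / 2 ^ k = 2 * (Q.side / 2 ^ (k + 1)) := by
    field_simp
    ring
  refine ⟨fun i => le_trans ?_ (hy.1 i), fun i => (hy.2 i).trans ?_⟩ <;>
    simp only [dyadic, Q.dyadicIndex_succ k x i, he]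
  · have : ((Q.dyadicIndex (k + 1) x i / 2 : ℤ) : ℝ) * 2 ≤ Q.dyadicIndex (k + 1) x i := by
      exact_mod_cast (by omega : Q.dyadicIndex (k + 1) x i / 2 * 2 ≤ _)
    nlinarith
  · have : (Q.dyadicIndex (k + 1) x i : ℝ) + 1 ≤
        ((Q.dyadicIndex (k + 1) x i / 2 : ℤ) : ℝ) * 2 + 2 := by
      exact_mod_cast (by omega : Q.dyadicIndex (k + 1) x i + 1 ≤ _)
    nlinarith

theorem Cube.dyadic_succ_vol (k : ℕ) (j j' : Fin n → ℤ) :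
    (Q.dyadic k j).vol = 2 ^ n * (Q.dyadic (k + 1) j').vol := by
  rw [Cube.vol_eq, Cube.vol_eq, ← mul_pow]
  congr 1
  simp only [dyadic]
  field_simp
  ring

/-- The metric on `Fin n → ℝ` is the sup metric, so the differentiation theorem for balls applies to
cubes. -/
theorem Cube.toSet_eq_closedBall (Q : Cube n) :
    Q.toSet = Metric.closedBall (fun i => Q.corner i + Q.side / 2) (Q.side / 2) := by
  rw [closedBall_pi _ (by linarith [Q.side_pos]), Cube.toSet, ← Set.pi_univ_Icc]
  congr 1
  funext i
  rw [Real.Icc_eq_closedBall]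
  congr 1 <;> ring

/-- Lebesgue differentiation along balls that contain x without being centred there; dilation factor
1 is enough. -/
theorem ae_tendsto_dyadic_average {w : (Fin n → ℝ) → ℝ} (hw : LocallyIntegrable w volume) :
    ∀ᵐ x ∂volume, Filter.Tendsto
      (fun k => (∫ y in (Q.dyadic k (Q.dyadicIndex k x)).toSet, w y)
        / (Q.dyadic k (Q.dyadicIndex k x)).vol) Filter.atTop (nhds (w x)) := by
  filter_upwards [IsUnifLocDoublingMeasure.ae_tendsto_average volume hw 1] with x hx
  have h := hx (l := Filter.atTop)
    (fun k i => (Q.dyadic k (Q.dyadicIndex k x)).corner i + (Q.dyadic k (Q.dyadicIndex k x)).side / 2)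
    (fun k => (Q.dyadic k (Q.dyadicIndex k x)).side / 2) ?_ ?_
  · refine h.congr fun k => ?_
    rw [← Cube.toSet_eq_closedBall, setAverage_eq, ← Cube.vol_eq_real, smul_eq_mul]
    ring
  · refine tendsto_nhdsWithin_iff.2 ⟨?_, Filter.Eventually.of_forall fun k => ?_⟩
    · simp only [Cube.dyadic]
      have h2 : Filter.Tendsto (fun k : ℕ => Q.side / 2 * (1 / 2 : ℝ) ^ k) Filter.atTop
          (nhds (Q.side / 2 * 0)) :=
        (tendsto_pow_atTop_nhds_zero_of_lt_one (by norm_num) (by norm_num)).const_mul _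
      rw [mul_zero] at h2
      refine h2.congr fun k => ?_
      rw [one_div, inv_pow]
      ring
    · exact half_pos (Cube.side_pos _)
  · refine Filter.Eventually.of_forall fun k => ?_
    rw [one_mul, ← Cube.toSet_eq_closedBall]
    exact Q.dyadicIco_subset (Q.mem_dyadicIco.2 rfl)

end Dyadic

/-- The Calderón–Zygmund decomposition of a cube at a level not below the average. -/
theorem exists_calderonZygmund {w : (Fin n → ℝ) → ℝ} (hw : IsWeight w) (Q : Cube n) {l : ℝ}
    (hl : (∫ x in Q.toSet, w x) ≤ l * Q.vol) :
    ∃ (ι : Type) (_ : Countable ι) (R : ι → Cube n), (∀ i, (R i).toSet ⊆ Q.toSet) ∧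
      Pairwise (Function.onFun (AEDisjoint volume) fun i => (R i).toSet) ∧
      (∀ i, l * (R i).vol ≤ ∫ x in (R i).toSet, w x) ∧
      (∀ i, ∫ x in (R i).toSet, w x ≤ 2 ^ n * l * (R i).vol) ∧
      ∀ᵐ x ∂volume, x ∈ Q.toSet → x ∉ ⋃ i, (R i).toSet → w x ≤ l := by
  set bad : ℕ → (Fin n → ℤ) → Prop := fun k j =>
    l * (Q.dyadic k j).vol < ∫ x in (Q.dyadic k j).toSet, w x with hbad
  -- Stopping cubes: the first bad cube among the dyadic ancestors of some point. Minimality makes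
  -- them disjoint.
  set S : Set (ℕ × (Fin n → ℤ)) := {a | ∃ x ∈ Q.dyadicIco 0 0, Q.dyadicIndex a.1 x = a.2 ∧
    bad a.1 a.2 ∧ ∀ m < a.1, ¬ bad m (Q.dyadicIndex m x)} with hS
  refine ⟨S, inferInstance, fun a => Q.dyadic a.1.1 a.1.2, ?_, ?_, ?_, ?_, ?_⟩
  · rintro ⟨⟨k, j⟩, x, hx, hj, -, -⟩
    simp only at hj ⊢
    rw [← hj]
    exact Q.dyadic_subset hx k
  · rintro ⟨⟨k, j⟩, x, hx, hj, hb, hm⟩ ⟨⟨k', j'⟩, x', hx', hj', hb', hm'⟩ hne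
    simp only at hj hb hm hj' hb' hm'
    have hd : Disjoint (Q.dyadicIco k j) (Q.dyadicIco k' j') := by
      rw [Set.disjoint_left]
      intro y hy hy'
      rw [Q.mem_dyadicIco] at hy hy'
      have hkk : k = k' := by
        rcases lt_trichotomy k k' with h | h | h
        · refine absurd ?_ (hm' k h)
          rw [Q.dyadicIndex_eq_of_le h.le (hj'.trans hy'.symm), hy]
          exact hb
        · exact h
        · refine absurd ?_ (hm k' h)
          rw [Q.dyadicIndex_eq_of_le h.le (hj.trans hy.symm), hy']
          exact hb'
      subst hkk
      exact hne (by rw [Subtype.mk.injEq, Prod.mk.injEq]; exact ⟨rfl, hy.symm.trans hy'⟩)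
    exact hd.aedisjoint.congr (Q.dyadicIco_ae_eq k j).symm (Q.dyadicIco_ae_eq k' j').symm
  · rintro ⟨⟨k, j⟩, x, hx, hj, hb, hm⟩
    exact hb.le
  · rintro ⟨⟨k, j⟩, x, hx, hj, hb, hm⟩
    simp only at hj hb hm ⊢
    -- Q itself is not bad, because the level is at least its average. So a stopping cube has a
    -- parent, which is not bad and has 2^n times its volume.
    obtain _ | k := k
    · exfalso
      have e : Q.dyadic 0 j = Q := by
        have : j = 0 := by rw [← hj]; exact Q.mem_dyadicIco.1 hx
        subst this
        simp [Cube.dyadic]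
      rw [hbad, e] at hb
      exact absurd hl (not_le.2 hb)
    · have h := not_lt.1 (hm k (Nat.lt_succ_self k))
      rw [Q.dyadic_succ_vol k _ j] at h
      have hsub := Q.dyadic_succ_subset k x
      rw [hj] at hsub
      refine (hw.setIntegral_mono hsub subset_rfl).trans (h.trans (le_of_eq ?_))
      ring
  · filter_upwards [ae_tendsto_dyadic_average Q hw.1, Q.dyadicIco_zero_ae_eq.mem_iff]
      with x hx hx0 hxQ hxn
    have hx1 := hx0.2 hxQ
    have hnb : ∀ k, ¬ bad k (Q.dyadicIndex k x) := by
      classical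
      by_contra! hex
      refine hxn (Set.mem_iUnion.2 ⟨⟨(Nat.find hex, Q.dyadicIndex (Nat.find hex) x), x, hx1, rfl,
        Nat.find_spec hex, fun m hm => Nat.find_min hex hm⟩, ?_⟩)
      exact Q.dyadicIco_subset (Q.mem_dyadicIco.2 rfl)
    refine le_of_tendsto hx (Filter.Eventually.of_forall fun k => ?_)
    rw [div_le_iff₀ (Cube.vol_pos _)]
    exact not_lt.1 (hnb k)

end

/-! ### Growth of φ from small portions and from the reverse Hölder inequality -/

section

variable {n : ℕ} {w : (Fin n → ℝ) → ℝ}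

theorem setIntegral_iUnion_le {ι : Type} [Countable ι] {Q : Cube n} {R : ι → Cube n}
    (hRQ : ∀ i, (R i).toSet ⊆ Q.toSet)
    (hd : Pairwise (Function.onFun (AEDisjoint volume) fun i => (R i).toSet))
    {f g : (Fin n → ℝ) → ℝ} (hf : IntegrableOn f Q.toSet) (hg : IntegrableOn g Q.toSet)
    (h : ∀ i, ∫ x in (R i).toSet, f x ≤ ∫ x in (R i).toSet, g x) :
    ∫ x in ⋃ i, (R i).toSet, f x ≤ ∫ x in ⋃ i, (R i).toSet, g x := by
  have hm : ∀ i, NullMeasurableSet (R i).toSet volume := fun i =>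
    (R i).measurableSet.nullMeasurableSet
  have hs := Set.iUnion_subset hRQ
  exact hasSum_le h (hasSum_integral_iUnion_ae hm hd (hf.mono_set hs))
    (hasSum_integral_iUnion_ae hm hd (hg.mono_set hs))

/-- The Calderón–Zygmund decomposition at level `2 φ(t) / t`. -/
theorem exists_calderonZygmund_phi (hw : IsWeight w) (Q : Cube n) {t : ℝ} (ht : 0 < t)
    (htQ : t ≤ Q.vol) :
    ∃ (ι : Type) (_ : Countable ι) (R : ι → Cube n), (∀ i, (R i).toSet ⊆ Q.toSet) ∧
      Pairwise (Function.onFun (AEDisjoint volume) fun i => (R i).toSet) ∧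
      (∀ i, ∫ x in (R i).toSet, w x ≤ 2 ^ n * (2 * phi w Q t / t) * (R i).vol) ∧
      (∀ᵐ x ∂volume, x ∈ Q.toSet → x ∉ ⋃ i, (R i).toSet → w x ≤ 2 * phi w Q t / t) ∧
      volume.real (⋃ i, (R i).toSet) ≤ t / 2 := by
  have hp := phi_pos hw ht htQ
  -- The level is at least the average of w over Q, because φ(t) ≥ (t/|Q|) w(Q).
  have hl : (∫ x in Q.toSet, w x) ≤ 2 * phi w Q t / t * Q.vol := by
    have h := mul_integral_le_phi hw ht htQ
    have hQ := Q.vol_pos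
    have h' : ∫ x in Q.toSet, w x = Q.vol / t * (t / Q.vol * ∫ x in Q.toSet, w x) := by
      field_simp
    have h2 : Q.vol / t * (t / Q.vol * ∫ x in Q.toSet, w x) ≤ Q.vol / t * phi w Q t := by gcongr
    have h3 : 0 ≤ Q.vol / t * phi w Q t := by positivity
    have h4 : 2 * phi w Q t / t * Q.vol = 2 * (Q.vol / t * phi w Q t) := by ring
    linarith
  obtain ⟨ι, hι, R, hRQ, hd, hlow, hup, hae⟩ := exists_calderonZygmund hw Q hl
  refine ⟨ι, hι, R, hRQ, hd, hup, hae, ?_⟩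
  have hs := Set.iUnion_subset hRQ
  -- Summed over the cubes, the lower bounds give w average at least 2φ(t)/t on the union: Chebyshev
  -- with K = 2.
  refine measureReal_le_of_phi_le hw hs ht htQ one_lt_two ?_
  have h := setIntegral_iUnion_le hRQ hd (f := fun _ => 2 * phi w Q t / t)
    (integrable_const _) (hw.integrableOn Q) fun i => by
      rw [setIntegral_const, smul_eq_mul, ← Cube.vol_eq_real, mul_comm]
      exact hlow i
  rwa [setIntegral_const, smul_eq_mul, mul_comm] at h

/-- Small portions of a cube do not carry all of its `w`-mass, uniformly in the cube. -/
def SmallPortions (w : (Fin n → ℝ) → ℝ) : Prop :=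
  ∃ ε η : ℝ, 0 < ε ∧ 0 < η ∧ η < 1 ∧ ∀ (Q : Cube n) (E : Set (Fin n → ℝ)), E ⊆ Q.toSet →
    MeasurableSet E → volume.real E ≤ ε * Q.vol →
      ∫ x in E, w x ≤ (1 - η) * ∫ x in Q.toSet, w x

/-- Truncate at μ = K φ(t)/t. The excess over μ lives on E = {w > μ} inside the Calderón–Zygmund
cubes of the lower level l. If E fills only a small portion of a cube R, it carries at most a share
1 - η of the mass of R; otherwise the whole mass of R is at most 2^n l |R| ≤ c |R ∩ E|. Since |E| ≤
t/K, the second kind is negligible for large K. -/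
theorem SmallPortions.exists_phi_le (hw : IsWeight w) (h : SmallPortions w) :
    ∃ θ ρ : ℝ, 0 < θ ∧ θ < 1 ∧ 0 < ρ ∧ ρ < 1 ∧ ∀ (Q : Cube n) (t : ℝ), 0 < t → t ≤ Q.vol →
      phi w Q (θ * t) ≤ ρ * phi w Q t := by
  obtain ⟨ε, η, hε, hη, hη1, h⟩ := h
  obtain ⟨w₀, hw₀, hww₀⟩ := hw.exists_measurable
  -- The first summand makes c t/K ≤ (η/4) φ(t) in `e2`; the second gives l ≤ μ.
  set K : ℝ := 2 ^ (n + 3) / (ε * η) + 2 with hK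
  have hK2 : 2 ≤ K := by
    have : 0 ≤ 2 ^ (n + 3) / (ε * η) := by positivity
    linarith
  have hK0 : 0 < K := by linarith
  have hKε : 2 ^ (n + 1) * 2 ^ 2 ≤ K * (ε * η) := by
    have : 2 ^ (n + 3) / (ε * η) ≤ K := by linarith
    rw [div_le_iff₀ (by positivity)] at this
    calc _ = (2 : ℝ) ^ (n + 3) := by ring
      _ ≤ _ := this
  -- The total is (1-η) φ(t) from the mass on Ω, (η/4) φ(t) from `e2`, and (η/4) φ(t) from θ t μ in
  -- `e1`.
  refine ⟨η / (4 * K), 1 - η / 2, by positivity, ?_, by linarith, by linarith, ?_⟩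
  · rw [div_lt_one (by positivity)]
    linarith
  intro Q t ht htQ
  have hp := phi_pos hw ht htQ
  obtain ⟨ι, hι, R, hRQ, hd, hup, hae, hΩ⟩ := exists_calderonZygmund_phi hw Q ht htQ
  set Ω := ⋃ i, (R i).toSet with hΩd
  have hΩQ : Ω ⊆ Q.toSet := Set.iUnion_subset hRQ
  have hΩm : MeasurableSet Ω := MeasurableSet.iUnion fun i => (R i).measurableSet
  set μ := K * phi w Q t / t with hμ
  have hμ0 : 0 < μ := by positivity
  set l := 2 * phi w Q t / t with hl
  have hl0 : 0 < l := by positivity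
  have hlμ : l ≤ μ := by rw [hl, hμ]; gcongr
  set E : Set (Fin n → ℝ) := Q.toSet ∩ {x | μ < w₀ x} with hE
  have hEm : MeasurableSet E := Q.measurableSet.inter (measurableSet_lt measurable_const hw₀)
  have hEQ : E ⊆ Q.toSet := Set.inter_subset_left
  have hEfin : volume E ≠ ⊤ := ne_top_of_le_ne_top Q.volume_ne_top (measure_mono hEQ)
  have hiw := hw.integrableOn Q
  have hE1 : volume.real E ≤ t / K := by
    refine measureReal_le_of_phi_le hw hEQ ht htQ (by linarith) ?_
    have : ∫ x in E, μ ≤ ∫ x in E, w x := by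
      refine setIntegral_mono_on_ae (integrableOn_const hEfin) (hiw.mono_set hEQ) hEm ?_
      filter_upwards [hww₀] with x hx hxE
      rw [hx]
      exact hxE.2.le
    rwa [setIntegral_const, smul_eq_mul, mul_comm] at this
  set c := 2 ^ n * l / ε with hc
  have hc0 : 0 < c := by positivity
  have hi1 : IntegrableOn (E.indicator w) Q.toSet := hiw.indicator hEm
  have hi2 : IntegrableOn (E.indicator fun _ => c) Q.toSet :=
    IntegrableOn.indicator (integrable_const _) hEm
  have hi3 : IntegrableOn (fun x => (1 - η) * w x) Q.toSet := hiw.const_mul _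
  have hind : ∀ T : Set (Fin n → ℝ), ∫ x in T, E.indicator (fun _ => c) x
      = c * volume.real (T ∩ E) := fun T => by
    rw [setIntegral_indicator hEm, setIntegral_const, smul_eq_mul, mul_comm]
  have hsum : ∫ x in Ω, E.indicator w x ≤
      ∫ x in Ω, ((1 - η) * w x + E.indicator (fun _ => c) x) := by
    refine setIntegral_iUnion_le hRQ hd hi1 (hi3.add hi2) fun i => ?_
    have hi := hRQ i
    rw [integral_add (hi3.mono_set hi) (hi2.mono_set hi), integral_const_mul,
      setIntegral_indicator hEm, hind]
    have hnn := hw.setIntegral_nonneg (R i).toSet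
    by_cases hsmall : volume.real ((R i).toSet ∩ E) ≤ ε * (R i).vol
    · have h1 := h (R i) _ Set.inter_subset_left ((R i).measurableSet.inter hEm) hsmall
      have : 0 ≤ c * volume.real ((R i).toSet ∩ E) := by positivity
      linarith
    · have h1 : ∫ x in (R i).toSet ∩ E, w x ≤ ∫ x in (R i).toSet, w x :=
        hw.setIntegral_mono Set.inter_subset_left subset_rfl
      have h2 : 2 ^ n * l * (R i).vol ≤ c * volume.real ((R i).toSet ∩ E) := by
        rw [hc, div_mul_eq_mul_div, le_div_iff₀ hε, mul_assoc (2 ^ n * l), mul_comm _ ε]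
        exact mul_le_mul_of_nonneg_left (not_le.1 hsmall).le (by positivity)
      have h3 := hup i
      have h4 : 0 ≤ (1 - η) * ∫ x in (R i).toSet, w x := mul_nonneg (by linarith) hnn
      linarith
  rw [integral_add (hi3.mono_set hΩQ) (hi2.mono_set hΩQ), integral_const_mul, hind] at hsum
  have hΩφ : ∫ x in Ω, w x ≤ phi w Q t := setIntegral_le_phi_of_le hw hΩQ ht (by linarith)
  have hΩE : volume.real (Ω ∩ E) ≤ t / K :=
    (measureReal_mono Set.inter_subset_right hEfin).trans hE1
  have hmain : ∫ x in Q.toSet, max (w x - μ) 0 ≤ ∫ x in Ω, E.indicator w x := by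
    have e : ∫ x in Ω, E.indicator w x = ∫ x in Q.toSet, Ω.indicator (E.indicator w) x := by
      rw [setIntegral_indicator hΩm, Set.inter_eq_self_of_subset_right hΩQ]
    rw [e]
    refine setIntegral_mono_on_ae (hiw.sub (integrable_const μ)).pos_part (hi1.indicator hΩm)
      Q.measurableSet ?_
    filter_upwards [hae, hww₀, hw.2] with x hx hx₀ hxp hxQ
    rcases le_or_gt (w x) μ with hle | hgt
    · rw [max_eq_right (by linarith)]
      exact Set.indicator_apply_nonneg fun _ => Set.indicator_apply_nonneg fun _ => hxp.le
    · have hxΩ : x ∈ Ω := by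
        by_contra hn
        exact absurd (hx hxQ hn) (not_le.2 (hlμ.trans_lt hgt))
      have hxE : x ∈ E := ⟨hxQ, by simpa [← hx₀] using hgt⟩
      rw [Set.indicator_of_mem hxΩ, Set.indicator_of_mem hxE, max_eq_left (by linarith)]
      linarith
  refine (phi_le hw Q (by positivity) hμ0.le).trans ?_
  have e1 : η / (4 * K) * t * μ = η / 4 * phi w Q t := by
    rw [hμ]; field_simp
  have e2 : c * volume.real (Ω ∩ E) ≤ η / 4 * phi w Q t := by
    calc c * volume.real (Ω ∩ E) ≤ c * (t / K) := by gcongr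
      _ = 2 ^ (n + 1) / (ε * K) * phi w Q t := by rw [hc, hl]; field_simp; ring
      _ ≤ η / 4 * phi w Q t := by
        gcongr ?_ * _
        rw [div_le_div_iff₀ (by positivity) (by norm_num)]
        linarith
  have e3 : (1 - η) * ∫ x in Ω, w x ≤ (1 - η) * phi w Q t :=
    mul_le_mul_of_nonneg_left hΩφ (by linarith)
  linarith

/-- Uniform power growth of the functions `φ_{w,Q}`. -/
def PhiGrowth (w : (Fin n → ℝ) → ℝ) (δ C : ℝ) : Prop :=
  ∀ (Q : Cube n) (s t : ℝ), 0 < s → s ≤ t → t ≤ Q.vol →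
    phi w Q s ≤ C * (s / t) ^ δ * phi w Q t

/-- Iteration gives φ(θ^k t) ≤ ρ^k φ(t), and δ = log ρ / log θ satisfies θ^δ = ρ. Monotonicity of φ
covers s between consecutive powers, at the cost of a factor ρ⁻¹. -/
theorem exists_phiGrowth_of_phi_le (hw : IsWeight w) {θ ρ : ℝ} (hθ : 0 < θ) (hθ1 : θ < 1)
    (hρ : 0 < ρ) (hρ1 : ρ < 1)
    (h : ∀ (Q : Cube n) (t : ℝ), 0 < t → t ≤ Q.vol → phi w Q (θ * t) ≤ ρ * phi w Q t) :
    ∃ δ C : ℝ, 0 < δ ∧ 1 ≤ C ∧ PhiGrowth w δ C := by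
  have hlθ := Real.log_neg hθ hθ1
  have hlρ := Real.log_neg hρ hρ1
  have hδ : 0 < Real.log ρ / Real.log θ := div_pos_of_neg_of_neg hlρ hlθ
  have hθρ : θ ^ (Real.log ρ / Real.log θ) = ρ := by
    rw [Real.rpow_def_of_pos hθ, mul_div_cancel₀ _ hlθ.ne, Real.exp_log hρ]
  refine ⟨Real.log ρ / Real.log θ, ρ⁻¹, hδ, (one_le_inv₀ hρ).2 hρ1.le, ?_⟩
  intro Q s t hs hst htQ
  have ht : 0 < t := hs.trans_le hst
  obtain ⟨k, hk1, hk2⟩ := exists_nat_pow_near_of_lt_one (div_pos hs ht) ((div_le_one ht).2 hst)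
    hθ hθ1
  have hit : ∀ k : ℕ, phi w Q (θ ^ k * t) ≤ ρ ^ k * phi w Q t := by
    intro k
    induction k with
    | zero => simp
    | succ k ih =>
      have h1 : θ ^ k * t ≤ Q.vol :=
        (mul_le_of_le_one_left ht.le (pow_le_one₀ hθ.le hθ1.le)).trans htQ
      calc phi w Q (θ ^ (k + 1) * t) = phi w Q (θ * (θ ^ k * t)) := by congr 1; ring
        _ ≤ ρ * phi w Q (θ ^ k * t) := h Q _ (by positivity) h1
        _ ≤ ρ * (ρ ^ k * phi w Q t) := by gcongr
        _ = _ := by ring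
  have hp := phi_nonneg (w := w) (Q := Q) ht.le
  calc phi w Q s ≤ phi w Q (θ ^ k * t) := phi_mono hw hs.le ((div_le_iff₀ ht).1 hk2)
    _ ≤ ρ ^ k * phi w Q t := hit k
    _ = ρ⁻¹ * ρ ^ (k + 1) * phi w Q t := by rw [pow_succ]; field_simp
    _ ≤ ρ⁻¹ * (s / t) ^ (Real.log ρ / Real.log θ) * phi w Q t := by
      gcongr
      calc ρ ^ (k + 1) = (θ ^ (k + 1)) ^ (Real.log ρ / Real.log θ) := by
            rw [← Real.rpow_natCast θ, ← Real.rpow_mul hθ.le, mul_comm, Real.rpow_mul hθ.le, hθρ,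
              Real.rpow_natCast]
        _ ≤ _ := Real.rpow_le_rpow (by positivity) hk1.le hδ.le

theorem SmallPortions.exists_phiGrowth (hw : IsWeight w) (h : SmallPortions w) :
    ∃ δ C : ℝ, 0 < δ ∧ 1 ≤ C ∧ PhiGrowth w δ C := by
  obtain ⟨θ, ρ, hθ, hθ1, hρ, hρ1, h⟩ := h.exists_phi_le hw
  exact exists_phiGrowth_of_phi_le hw hθ hθ1 hρ hρ1 h

/-- The reverse Hölder inequality forces power growth of `φ_{w,Q}` with exponent `1 - 1 / q`. -/
theorem phiGrowth_of_reverseHolder (hw : IsWeight w) {q C : ℝ} (hq : 1 < q) (hC : 0 < C)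
    (h : ∀ Q : Cube n, IntegrableOn (fun x => w x ^ q) Q.toSet ∧
      ∫ x in Q.toSet, w x ^ q ≤ C * (Q.vol * ((∫ x in Q.toSet, w x) / Q.vol) ^ q)) :
    PhiGrowth w (1 - 1 / q) (C * (2 ^ n) ^ q + 2) := by
  intro Q s t hs hst htQ
  have ht : 0 < t := hs.trans_le hst
  have hp := phi_pos hw ht htQ
  have hq0 : 0 < q := by linarith
  obtain ⟨ι, hι, R, hRQ, hd, hup, hae, hΩ⟩ := exists_calderonZygmund_phi hw Q ht htQ
  set Ω := ⋃ i, (R i).toSet with hΩd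
  have hΩQ : Ω ⊆ Q.toSet := Set.iUnion_subset hRQ
  have hΩm : MeasurableSet Ω := MeasurableSet.iUnion fun i => (R i).measurableSet
  set l := 2 * phi w Q t / t with hl
  have hl0 : 0 < l := by positivity
  set c := C * (2 ^ n * l) ^ q with hc
  have hc0 : 0 < c := by positivity
  have hsum : ∫ x in Ω, w x ^ q ≤ c * (t / 2) := by
    have h1 : ∫ x in Ω, w x ^ q ≤ ∫ x in Ω, c := by
      refine setIntegral_iUnion_le hRQ hd (h Q).1 (integrable_const _) fun i => ?_
      rw [setIntegral_const, smul_eq_mul, ← Cube.vol_eq_real]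
      have hv := (R i).vol_pos
      calc _ ≤ C * ((R i).vol * ((∫ x in (R i).toSet, w x) / (R i).vol) ^ q) := (h (R i)).2
        _ ≤ C * ((R i).vol * (2 ^ n * l) ^ q) := by
          have := hw.setIntegral_nonneg (R i).toSet
          gcongr
          rw [div_le_iff₀ hv]
          exact hup i
        _ = _ := by rw [hc]; ring
    rw [setIntegral_const, smul_eq_mul, mul_comm] at h1
    exact h1.trans (by gcongr)
  have hts : 1 ≤ t / s := (one_le_div hs).2 hst
  -- This height balances the two terms of `phi_le`: s μ and μ^(1-q) l^q t are both multiples of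
  -- (s/t)^(1-1/q) φ(t).
  set μ := l * (t / s) ^ (1 / q) with hμ
  have hlμ : l ≤ μ := le_mul_of_one_le_right hl0.le (Real.one_le_rpow hts (by positivity))
  have hμ0 : 0 < μ := hl0.trans_le hlμ
  -- Where w > μ, the point lies in Ω almost surely, and w = w^(1-q) w^q ≤ μ^(1-q) w^q as q > 1.
  have hmain : ∫ x in Q.toSet, max (w x - μ) 0 ≤ μ ^ (1 - q) * ∫ x in Ω, w x ^ q := by
    have e : ∫ x in Ω, w x ^ q = ∫ x in Q.toSet, Ω.indicator (fun x => w x ^ q) x := by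
      rw [setIntegral_indicator hΩm, Set.inter_eq_self_of_subset_right hΩQ]
    rw [e, ← integral_const_mul]
    refine setIntegral_mono_on_ae ((hw.integrableOn Q).sub (integrable_const μ)).pos_part
      (((h Q).1.indicator hΩm).const_mul _) Q.measurableSet ?_
    filter_upwards [hae, hw.2] with x hx hxp hxQ
    rcases le_or_gt (w x) μ with hle | hgt
    · rw [max_eq_right (by linarith)]
      exact mul_nonneg (by positivity)
        (Set.indicator_apply_nonneg fun _ => Real.rpow_nonneg hxp.le q)
    · have hxΩ : x ∈ Ω := by
        by_contra hn
        exact absurd (hx hxQ hn) (not_le.2 (hlμ.trans_lt hgt))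
      rw [Set.indicator_of_mem hxΩ, max_eq_left (by linarith)]
      have h1 : w x = w x ^ (1 - q) * w x ^ q := by
        rw [← Real.rpow_add hxp, sub_add_cancel, Real.rpow_one]
      have h2 : w x ^ (1 - q) ≤ μ ^ (1 - q) :=
        Real.rpow_le_rpow_of_nonpos hμ0 hgt.le (by linarith)
      have h3 := mul_le_mul_of_nonneg_right h2 (Real.rpow_nonneg hxp.le q)
      linarith
  refine (phi_le hw Q hs.le hμ0.le).trans ?_
  set a := (s / t) ^ (1 - 1 / q) with ha
  have hst0 : 0 < s / t := by positivity
  have e0 : (t / s : ℝ) = (s / t)⁻¹ := (inv_div s t).symm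
  have e1 : s * μ = 2 * a * phi w Q t := by
    have : (t / s) ^ (1 / q) = a * (t / s) := by
      rw [ha, e0, Real.inv_rpow hst0.le, ← Real.rpow_neg hst0.le, Real.rpow_sub hst0, Real.rpow_one,
        Real.rpow_neg hst0.le]
      field_simp
    rw [hμ, this, hl]
    field_simp
  have e2 : μ ^ (1 - q) * (c * (t / 2)) = C * (2 ^ n) ^ q * a * phi w Q t := by
    have h1 : μ ^ (1 - q) = l ^ (1 - q) * a := by
      rw [hμ, Real.mul_rpow hl0.le (by positivity), ← Real.rpow_mul (by positivity), ha, e0,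
        Real.inv_rpow hst0.le, ← Real.rpow_neg hst0.le]
      congr 2
      field_simp
      ring
    have h2 : l ^ (1 - q) * l ^ q = l := by
      rw [← Real.rpow_add hl0, sub_add_cancel, Real.rpow_one]
    rw [h1, hc, Real.mul_rpow (by positivity) hl0.le]
    calc _ = (l ^ (1 - q) * l ^ q) * a * C * (2 ^ n) ^ q * (t / 2) := by ring
      _ = _ := by rw [h2, hl]; field_simp
  calc _ ≤ μ ^ (1 - q) * (c * (t / 2)) + s * μ := by
        gcongr
        exact hmain.trans (by gcongr)
    _ = _ := by rw [e1, e2]; ring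

end

section

variable {n : ℕ} {w : (Fin n → ℝ) → ℝ}

/-! ### The index and power bounds for φ -/

section Index

theorem lt_ind_iff {ψ : Cube n → ℝ → ℝ} {a : ℝ} :
    (a : EReal) < ind ψ ↔ ∃ δ : ℝ, 0 ≤ δ ∧ a < δ ∧ ∃ γ ∈ Set.Ioo (0 : ℝ) 1, ∃ C : ℝ,
      ∀ Q : Cube n, AlmostIncreasing (fun s => ψ Q s * s ^ (-δ)) (γ * Q.vol) C := by
  rw [ind, lt_sSup_iff]
  constructor
  · rintro ⟨D, ⟨δ, hδ, rfl, h⟩, haD⟩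
    exact ⟨δ, hδ, EReal.coe_lt_coe_iff.1 haD, h⟩
  · rintro ⟨δ, hδ, haδ, h⟩
    exact ⟨δ, ⟨δ, hδ, rfl, h⟩, EReal.coe_lt_coe_iff.2 haδ⟩

theorem PhiGrowth.lt_ind {δ C a : ℝ} (h : PhiGrowth w δ C) (hC : 1 ≤ C) (hδ : 0 ≤ δ)
    (ha : a < δ) : (a : EReal) < ind (phi (n := n) w) := by
  refine lt_ind_iff.2 ⟨δ, hδ, ha, 1 / 2, ⟨by norm_num, by norm_num⟩, C, fun Q => ⟨hC, ?_, ?_⟩⟩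
  · intro s hs
    exact mul_nonneg (phi_nonneg hs.1.le) (Real.rpow_nonneg hs.1.le _)
  · intro s hs t ht hst
    have hs0 := hs.1
    have ht0 := ht.1
    have hQ := Q.vol_pos
    have h1 := h Q s t hs0 hst (by linarith [ht.2])
    calc phi w Q s * s ^ (-δ) ≤ C * (s / t) ^ δ * phi w Q t * s ^ (-δ) := by gcongr
      _ = C * (phi w Q t * t ^ (-δ)) := by
        rw [Real.div_rpow hs0.le ht0.le, Real.rpow_neg hs0.le, Real.rpow_neg ht0.le]
        have := Real.rpow_pos_of_pos hs0 δ
        have := Real.rpow_pos_of_pos ht0 δ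
        field_simp

/-- Uniform power decay of `φ_{w,Q}(s)` relative to the mass of `w` on `Q`. -/
def PhiDecay (w : (Fin n → ℝ) → ℝ) (δ A : ℝ) : Prop :=
  ∀ (Q : Cube n) (s : ℝ), 0 < s → s ≤ Q.vol →
    phi w Q s ≤ A * (s / Q.vol) ^ δ * ∫ x in Q.toSet, w x

/-- Compare φ(s) with φ at t = γ|Q|/2, inside the range of almost monotonicity, where φ(t) ≤ w(Q).
For s ≥ t the trivial bound φ(s) ≤ w(Q) suffices. -/
theorem exists_phiDecay_of_lt_ind (hw : IsWeight w) {a : ℝ}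
    (h : (a : EReal) < ind (phi (n := n) w)) :
    ∃ δ A : ℝ, 0 ≤ δ ∧ a < δ ∧ 1 ≤ A ∧ PhiDecay w δ A := by
  obtain ⟨δ, hδ, haδ, γ, ⟨hγ, hγ1⟩, C, h⟩ := lt_ind_iff.1 h
  have hC : 1 ≤ C := (h ⟨0, 1, one_pos⟩).1
  have hγ2 : 1 ≤ (2 / γ) ^ δ := Real.one_le_rpow ((one_le_div hγ).2 (by linarith)) hδ
  have hCγ : (2 / γ) ^ δ ≤ C * (2 / γ) ^ δ := le_mul_of_one_le_left (by positivity) hC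
  refine ⟨δ, C * (2 / γ) ^ δ, hδ, haδ, hγ2.trans hCγ, fun Q s hs hsQ => ?_⟩
  have hQ := Q.vol_pos
  set t := γ * Q.vol / 2 with ht
  have ht0 : 0 < t := by positivity
  have htγ : t < γ * Q.vol := by rw [ht]; linarith [mul_pos hγ hQ]
  have e : (2 / γ) ^ δ * (s / Q.vol) ^ δ = (s / t) ^ δ := by
    rw [← Real.mul_rpow (by positivity) (by positivity)]
    congr 1
    rw [ht]
    field_simp
  rw [mul_assoc C, e]
  have hI := hw.setIntegral_nonneg Q.toSet
  rcases le_total s t with hst | hst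
  · have h1 := (h Q).2.2 s ⟨hs, hst.trans_lt htγ⟩ t ⟨ht0, htγ⟩ hst
    simp only at h1
    have hs1 := Real.rpow_pos_of_pos hs δ
    have ht1 := Real.rpow_pos_of_pos ht0 δ
    rw [Real.rpow_neg hs.le, Real.rpow_neg ht0.le, ← div_eq_mul_inv, div_le_iff₀ hs1] at h1
    calc phi w Q s ≤ C * (s / t) ^ δ * phi w Q t := by
          refine h1.trans (le_of_eq ?_)
          rw [Real.div_rpow hs.le ht0.le]
          field_simp
      _ ≤ _ := by gcongr; exact phi_le_integral hw ht0.le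
  · refine (phi_le_integral hw hs.le).trans (le_mul_of_one_le_left hI ?_)
    exact one_le_mul_of_one_le_of_one_le hC (Real.one_le_rpow ((one_le_div ht0).2 hst) hδ)

theorem PhiDecay.mono {δ δ' A : ℝ} (hw : IsWeight w) (h : PhiDecay w δ A) (hA : 0 ≤ A)
    (hδ : δ' ≤ δ) : PhiDecay w δ' A := by
  intro Q s hs hsQ
  have hQ := Q.vol_pos
  have hI := hw.setIntegral_nonneg Q.toSet
  refine (h Q s hs hsQ).trans ?_
  gcongr ?_ * ?_ * _
  exact Real.rpow_le_rpow_of_exponent_ge (by positivity) ((div_le_one hQ).2 hsQ) hδ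

theorem phiParam_mul_rpow {β q δ : ℝ} (hq : 0 < q) (Q : Cube n) {s : ℝ} (hs : 0 < s) :
    phiParam w β q Q s * s ^ (-δ) = (phi w Q s * s ^ (-(β + δ / q))) ^ q := by
  have hp := phi_nonneg (w := w) (Q := Q) hs.le
  rw [phiParam, Real.mul_rpow (by positivity) hp, Real.mul_rpow hp (by positivity),
    ← Real.rpow_mul hs.le, ← Real.rpow_mul hs.le, mul_comm (s ^ _), mul_assoc, ← Real.rpow_add hs]
  congr 2
  field_simp
  ring

/-- By `phiParam_mul_rpow`, exponent δ for the parametrised family corresponds to β + δ/q for φ, the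
constants being related by q-th powers. -/
theorem zero_lt_ind_phiParam_iff {β q : ℝ} (hβ : 0 ≤ β) (hq : 0 < q) :
    0 < ind (phiParam (n := n) w β q) ↔ (β : EReal) < ind (phi (n := n) w) := by
  rw [← EReal.coe_zero, lt_ind_iff, lt_ind_iff]
  constructor
  · rintro ⟨δ, hδ, hδ0, γ, hγ, C, h⟩
    refine ⟨β + δ / q, by positivity, by linarith [div_pos hδ0 hq], γ, hγ, C ^ (1 / q),
      fun Q => ⟨Real.one_le_rpow (h Q).1 (by positivity), fun s hs =>
        mul_nonneg (phi_nonneg hs.1.le) (Real.rpow_nonneg hs.1.le _), fun s hs t ht hst => ?_⟩⟩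
    have h1 := (h Q).2.2 s hs t ht hst
    simp only at h1 ⊢
    rw [phiParam_mul_rpow hq Q hs.1, phiParam_mul_rpow hq Q ht.1] at h1
    have hC : 0 ≤ C := zero_le_one.trans (h Q).1
    have hs2 := mul_nonneg (phi_nonneg (w := w) (Q := Q) hs.1.le)
      (Real.rpow_nonneg hs.1.le (-(β + δ / q)))
    have ht2 := mul_nonneg (phi_nonneg (w := w) (Q := Q) ht.1.le)
      (Real.rpow_nonneg ht.1.le (-(β + δ / q)))
    refine (Real.rpow_le_rpow_iff hs2 (by positivity) hq).1 (h1.trans (le_of_eq ?_))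
    rw [Real.mul_rpow (by positivity) ht2, ← Real.rpow_mul hC, one_div_mul_cancel hq.ne',
      Real.rpow_one]
  · rintro ⟨δ, hδ, hβδ, γ, hγ, C, h⟩
    have e : β + q * (δ - β) / q = δ := by field_simp; ring
    refine ⟨q * (δ - β), by nlinarith, by nlinarith, γ, hγ, C ^ q,
      fun Q => ⟨Real.one_le_rpow (h Q).1 hq.le, fun s hs => ?_, fun s hs t ht hst => ?_⟩⟩
    · simp only
      rw [phiParam_mul_rpow hq Q hs.1, e]
      exact Real.rpow_nonneg ((h Q).2.1 s hs) q
    · simp only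
      rw [phiParam_mul_rpow hq Q hs.1, phiParam_mul_rpow hq Q ht.1, e,
        ← Real.mul_rpow (zero_le_one.trans (h Q).1) ((h Q).2.1 t ht)]
      exact Real.rpow_le_rpow ((h Q).2.1 s hs) ((h Q).2.2 s hs t ht hst) hq.le

end Index

/-! ### From the index to the reverse Hölder inequality -/

section ReverseHolder

theorem lintegral_ofReal_le_iff {α : Type*} [MeasurableSpace α] {μ : Measure α} {f : α → ℝ}
    (hf : AEStronglyMeasurable f μ) (h0 : 0 ≤ᵐ[μ] f) {K : ℝ} (hK : 0 ≤ K) :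
    ∫⁻ x, ENNReal.ofReal (f x) ∂μ ≤ ENNReal.ofReal K ↔ Integrable f μ ∧ ∫ x, f x ∂μ ≤ K := by
  constructor
  · intro h
    refine ⟨⟨hf, ?_⟩, ?_⟩
    · rw [hasFiniteIntegral_iff_ofReal h0]
      exact h.trans_lt ENNReal.ofReal_lt_top
    · rw [integral_eq_lintegral_of_nonneg_ae h0 hf]
      exact ENNReal.toReal_le_of_le_ofReal hK h
  · rintro ⟨hi, h⟩
    rw [← ofReal_integral_eq_lintegral_ofReal hi h0]
    exact ENNReal.ofReal_le_ofReal h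

/-- The reverse Hölder inequality with exponent `p`, for Bochner integrals. -/
def ReverseHolder (w : (Fin n → ℝ) → ℝ) (p : ℝ) : Prop :=
  ∃ C : ℝ, 0 < C ∧ ∀ Q : Cube n, IntegrableOn (fun x => w x ^ p) Q.toSet ∧
    ∫ x in Q.toSet, w x ^ p ≤ C * (Q.vol * ((∫ x in Q.toSet, w x) / Q.vol) ^ p)

theorem IsWeight.aestronglyMeasurable_rpow (hw : IsWeight w) (p : ℝ) (E : Set (Fin n → ℝ)) :
    AEStronglyMeasurable (fun x => w x ^ p) (volume.restrict E) :=
  (hw.1.aestronglyMeasurable.aemeasurable.pow_const p).aestronglyMeasurable.restrict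

theorem IsWeight.rpow_ae_nonneg (hw : IsWeight w) (p : ℝ) (E : Set (Fin n → ℝ)) :
    0 ≤ᵐ[volume.restrict E] fun x => w x ^ p :=
  (hw.ae_pos E).mono fun _ hx => Real.rpow_nonneg hx.le p

theorem IsWeight.lintegral_rpow_le_iff (hw : IsWeight w) (p : ℝ) (Q : Cube n) {K : ℝ}
    (hK : 0 ≤ K) :
    ∫⁻ x in Q.toSet, ENNReal.ofReal (w x ^ p) ≤ ENNReal.ofReal K ↔
      IntegrableOn (fun x => w x ^ p) Q.toSet ∧ ∫ x in Q.toSet, w x ^ p ≤ K :=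
  lintegral_ofReal_le_iff (hw.aestronglyMeasurable_rpow p _) (hw.rpow_ae_nonneg p _) hK

theorem Cube.avg_le_ofReal_iff {Q : Cube n} {f : (Fin n → ℝ) → ENNReal} {K : ℝ} :
    Q.avg f ≤ ENNReal.ofReal K ↔ ∫⁻ x in Q.toSet, f x ≤ ENNReal.ofReal (K * Q.vol) := by
  rw [Cube.avg, ENNReal.div_le_iff Q.volume_ne_zero Q.volume_ne_top,
    ENNReal.ofReal_mul' Q.vol_pos.le, Q.volume_eq_ofReal]

theorem mem_RHp_iff {p : ℝ} (hp : 1 < p) :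
    w ∈ RHp n p ↔ IsWeight w ∧ ReverseHolder w p := by
  have hp0 : 0 < p := by linarith
  refine and_congr_right fun hw => ?_
  have key : ∀ (C : ℝ), 0 < C → ∀ Q : Cube n,
      ((Q.avg (fun x => ENNReal.ofReal (w x ^ p))) ^ (1 / p)
        ≤ ENNReal.ofReal C * Q.avg (fun x => ENNReal.ofReal (w x)) ↔
      (IntegrableOn (fun x => w x ^ p) Q.toSet ∧
        ∫ x in Q.toSet, w x ^ p ≤ C ^ p * (Q.vol * ((∫ x in Q.toSet, w x) / Q.vol) ^ p))) := by
    intro C hC Q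
    have hQ := Q.vol_pos
    have hI := hw.setIntegral_nonneg Q.toSet
    rw [hw.avg_eq, ← ENNReal.ofReal_mul hC.le, one_div, ENNReal.rpow_inv_le_iff hp0,
      ENNReal.ofReal_rpow_of_nonneg (by positivity) hp0.le, Cube.avg_le_ofReal_iff,
      hw.lintegral_rpow_le_iff p Q (by positivity), Real.mul_rpow hC.le (by positivity)]
    rw [show C ^ p * ((∫ x in Q.toSet, w x) / Q.vol) ^ p * Q.vol
      = C ^ p * (Q.vol * ((∫ x in Q.toSet, w x) / Q.vol) ^ p) by ring]
  constructor
  · rintro ⟨C, hC, h⟩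
    exact ⟨C ^ p, by positivity, fun Q => (key C hC Q).1 (h Q)⟩
  · rintro ⟨C, hC, h⟩
    refine ⟨C ^ (1 / p), by positivity, fun Q => (key _ (by positivity) Q).2 ?_⟩
    rw [← Real.rpow_mul hC.le, one_div_mul_cancel hp0.ne', Real.rpow_one]
    exact h Q

theorem ReverseHolder.lt_ind (hw : IsWeight w) {q a : ℝ} (hq : 1 < q) (h : ReverseHolder w q)
    (ha : a < 1 - 1 / q) : (a : EReal) < ind (phi (n := n) w) := by
  obtain ⟨C, hC, h⟩ := h
  refine (phiGrowth_of_reverseHolder hw hq hC h).lt_ind ?_ ?_ ha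
  · have : 0 ≤ C * (2 ^ n) ^ q := by positivity
    linarith
  · rw [sub_nonneg, div_le_one (by linarith)]
    exact hq.le

/-- The weak-type estimate that follows from the power decay of `φ_{w,Q}`. -/
theorem PhiDecay.measureReal_le {δ A : ℝ} (hw : IsWeight w) (h : PhiDecay w δ A) (hA : 0 < A)
    (hδ : δ < 1) {Q : Cube n} {E : Set (Fin n → ℝ)} (hEQ : E ⊆ Q.toSet) {l : ℝ} (hl : 0 < l)
    (hE : l * volume.real E ≤ ∫ x in E, w x) :
    volume.real E ≤ Q.vol * (A * ((∫ x in Q.toSet, w x) / Q.vol) / l) ^ (1 / (1 - δ)) := by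
  have hQ := Q.vol_pos
  have hI := hw.setIntegral_pos Q
  rcases (measureReal_nonneg (μ := volume) (s := E)).eq_or_lt with h0 | hs
  · rw [← h0]; positivity
  set s := volume.real E with hsd
  have hsQ : s ≤ Q.vol := Cube.measureReal_le_vol hEQ
  -- Evaluating φ at s = |E| gives l s ≤ A (s/|Q|)^δ w(Q); solving for s produces the power 1/(1-δ).
  have h1 := hE.trans ((setIntegral_le_phi_of_le hw hEQ hs le_rfl).trans (h Q s hs hsQ))
  have hx : 0 < s / Q.vol := by positivity
  have h2 : (s / Q.vol) ^ (1 - δ) ≤ A * ((∫ x in Q.toSet, w x) / Q.vol) / l := by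
    rw [Real.rpow_sub hx, Real.rpow_one, div_le_div_iff₀ (by positivity) hl]
    calc s / Q.vol * l = l * s / Q.vol := by ring
      _ ≤ A * (s / Q.vol) ^ δ * (∫ x in Q.toSet, w x) / Q.vol := by gcongr
      _ = _ := by ring
  rw [← div_le_iff₀' hQ]
  have h3 := Real.rpow_le_rpow (by positivity) h2 (z := 1 / (1 - δ))
    (one_div_nonneg.2 (by linarith))
  rwa [← Real.rpow_mul hx.le, mul_one_div_cancel (by linarith), Real.rpow_one] at h3

/-- Split at b: below it the trivial bound V gives V b^p/p; above it the decay of order r > p is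
integrable against l^(p-1). -/
theorem lintegral_rpow_tail_le {p r b : ℝ} (hp : 0 < p) (hr : p < r) (hb : 0 < b)
    {F : ℝ → ENNReal} {V : ℝ} (hV : 0 ≤ V) (h1 : ∀ l, 0 < l → F l ≤ ENNReal.ofReal V)
    (h2 : ∀ l, 0 < l → F l ≤ ENNReal.ofReal (V * (b / l) ^ r)) :
    ∫⁻ l in Set.Ioi 0, F l * ENNReal.ofReal (l ^ (p - 1)) ≤
      ENNReal.ofReal (V * b ^ p * (1 / p + 1 / (r - p))) := by
  have hrp : 0 < r - p := by linarith
  rw [← Set.Ioc_union_Ioi_eq_Ioi hb.le,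
    lintegral_union measurableSet_Ioi (Set.Ioc_disjoint_Ioi le_rfl), mul_add,
    ENNReal.ofReal_add (by positivity) (by positivity)]
  refine add_le_add ?_ ?_
  · have hint : IntervalIntegrable (fun l : ℝ => l ^ (p - 1)) volume 0 b :=
      intervalIntegral.intervalIntegrable_rpow' (by linarith)
    have hi : IntegrableOn (fun l : ℝ => V * l ^ (p - 1)) (Set.Ioc 0 b) :=
      ((intervalIntegrable_iff_integrableOn_Ioc_of_le hb.le).1 hint).const_mul V
    calc ∫⁻ l in Set.Ioc 0 b, F l * ENNReal.ofReal (l ^ (p - 1))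
        ≤ ∫⁻ l in Set.Ioc 0 b, ENNReal.ofReal (V * l ^ (p - 1)) := by
          refine setLIntegral_mono' measurableSet_Ioc fun l hl => ?_
          rw [ENNReal.ofReal_mul hV]
          exact mul_le_mul_left (h1 l hl.1) _
      _ = ENNReal.ofReal (∫ l in Set.Ioc 0 b, V * l ^ (p - 1)) := by
          refine (ofReal_integral_eq_lintegral_ofReal hi ?_).symm
          filter_upwards [ae_restrict_mem measurableSet_Ioc] with l hl
          exact mul_nonneg hV (Real.rpow_nonneg hl.1.le _)
      _ = ENNReal.ofReal (V * b ^ p * (1 / p)) := by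
          rw [integral_const_mul, ← intervalIntegral.integral_of_le hb.le,
            integral_rpow (Or.inl (by linarith)), sub_add_cancel, Real.zero_rpow hp.ne', sub_zero]
          congr 1
          ring
      _ ≤ _ := le_rfl
  · have hlt : p - 1 - r < -1 := by linarith
    have hi : IntegrableOn (fun l : ℝ => V * b ^ r * l ^ (p - 1 - r)) (Set.Ioi b) :=
      (integrableOn_Ioi_rpow_of_lt hlt hb).const_mul _
    calc ∫⁻ l in Set.Ioi b, F l * ENNReal.ofReal (l ^ (p - 1))
        ≤ ∫⁻ l in Set.Ioi b, ENNReal.ofReal (V * b ^ r * l ^ (p - 1 - r)) := by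
          refine setLIntegral_mono' measurableSet_Ioi fun l hl => ?_
          have hl0 : 0 < l := hb.trans hl
          have e : V * b ^ r * l ^ (p - 1 - r) = V * (b / l) ^ r * l ^ (p - 1) := by
            rw [Real.rpow_sub hl0 (p - 1) r, Real.div_rpow hb.le hl0.le]
            ring
          rw [e, ENNReal.ofReal_mul (by positivity)]
          exact mul_le_mul_left (h2 l hl0) _
      _ = ENNReal.ofReal (∫ l in Set.Ioi b, V * b ^ r * l ^ (p - 1 - r)) := by
          refine (ofReal_integral_eq_lintegral_ofReal hi ?_).symm
          filter_upwards [ae_restrict_mem measurableSet_Ioi] with l hl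
          exact mul_nonneg (by positivity) (Real.rpow_nonneg (hb.trans hl).le _)
      _ = ENNReal.ofReal (V * b ^ p * (1 / (r - p))) := by
          rw [integral_const_mul, integral_Ioi_rpow_of_lt hlt hb]
          have e : b ^ (p - 1 - r + 1) = b ^ p / b ^ r := by
            rw [← Real.rpow_sub hb]
            congr 1
            ring
          have hne : p - 1 - r + 1 = -(r - p) := by ring
          have := Real.rpow_pos_of_pos hb r
          rw [e, hne, neg_div_neg_eq]
          congr 1
          field_simp
      _ ≤ _ := le_rfl

theorem PhiDecay.reverseHolder {δ A p : ℝ} (hw : IsWeight w) (h : PhiDecay w δ A) (hA : 1 ≤ A)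
    (hp : 1 < p) (hδ : 1 - 1 / p < δ) : ReverseHolder w p := by
  have hp0 : 0 < p := by linarith
  have hA0 : 0 < A := by linarith
  -- Since s ≤ |Q|, lowering δ weakens the decay, so δ may be taken strictly between 1 - 1/p and 1,
  -- which makes r = 1/(1-δ) positive and finite.
  wlog hδ1 : δ < 1 generalizing δ
  · have h1 : 1 - 1 / p < 1 := by
      have : 0 < 1 / p := by positivity
      linarith
    obtain ⟨δ', hl, hr⟩ := exists_between h1
    exact this (h.mono hw hA0.le (hr.le.trans (not_lt.1 hδ1))) hl hr
  set r := 1 / (1 - δ) with hr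
  have hpr : p < r := by
    rw [hr, lt_one_div hp0 (by linarith)]
    linarith
  have hrp : 0 < r - p := by linarith
  obtain ⟨w₀, hw₀, hww₀⟩ := hw.exists_measurable
  refine ⟨p * (A ^ p * (1 / p + 1 / (r - p))), by positivity, fun Q => ?_⟩
  have hQ := Q.vol_pos
  have hI := hw.setIntegral_pos Q
  set a := (∫ x in Q.toSet, w x) / Q.vol with ha
  have ha0 : 0 < a := by positivity
  refine (hw.lintegral_rpow_le_iff p Q (by positivity)).1 ?_
  rw [lintegral_rpow_eq_lintegral_meas_lt_mul _ (hw.ae_nonneg _)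
    (hw.integrableOn Q).aestronglyMeasurable.aemeasurable hp0, mul_assoc p,
    ENNReal.ofReal_mul hp0.le]
  gcongr
  have e : A ^ p * (1 / p + 1 / (r - p)) * (Q.vol * a ^ p)
      = Q.vol * (A * a) ^ p * (1 / p + 1 / (r - p)) := by
    rw [Real.mul_rpow hA0.le ha0.le]
    ring
  rw [e]
  -- The distribution function of w on Q is at most |Q|, and the weak-type estimate takes over at b
  -- = A a, with a the average of w.
  refine lintegral_rpow_tail_le hp0 hpr (by positivity) hQ.le (fun l _ => ?_) fun l hl => ?_
  · rw [← Q.volume_eq_ofReal]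
    exact (measure_mono (Set.subset_univ _)).trans (by simp)
  · set E : Set (Fin n → ℝ) := Q.toSet ∩ {x | l < w₀ x} with hE
    have hEm : MeasurableSet E := Q.measurableSet.inter (measurableSet_lt measurable_const hw₀)
    have hEQ : E ⊆ Q.toSet := Set.inter_subset_left
    have hEfin : volume E ≠ ⊤ := ne_top_of_le_ne_top Q.volume_ne_top (measure_mono hEQ)
    have hvE : volume.restrict Q.toSet {x | l < w x} = volume E := by
      have : ({x | l < w x} : Set (Fin n → ℝ)) =ᵐ[volume.restrict Q.toSet] {x | l < w₀ x} := by
        filter_upwards [ae_restrict_of_ae hww₀] with x hx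
        exact propext (by change l < w x ↔ l < w₀ x; rw [hx])
      rw [measure_congr this, Measure.restrict_apply (measurableSet_lt measurable_const hw₀),
        Set.inter_comm]
    rw [hvE, ← ENNReal.ofReal_toReal hEfin]
    refine ENNReal.ofReal_le_ofReal (h.measureReal_le hw hA0 hδ1 hEQ hl ?_)
    have : ∫ x in E, l ≤ ∫ x in E, w x := by
      refine setIntegral_mono_on_ae (integrableOn_const hEfin)
        ((hw.integrableOn Q).mono_set hEQ) hEm ?_
      filter_upwards [hww₀] with x hx hxE
      rw [hx]
      exact hxE.2.le
    rwa [setIntegral_const, smul_eq_mul, mul_comm] at this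

theorem reverseHolder_of_lt_ind (hw : IsWeight w) {p : ℝ} (hp : 1 < p)
    (h : ((1 - 1 / p : ℝ) : EReal) < ind (phi (n := n) w)) : ReverseHolder w p := by
  obtain ⟨δ, A, -, hδ, hA, h⟩ := exists_phiDecay_of_lt_ind hw h
  exact h.reverseHolder hw hA hp hδ

theorem exists_reverseHolder_of_zero_lt_ind (hw : IsWeight w)
    (h : 0 < ind (phi (n := n) w)) : ∃ p, 1 < p ∧ ReverseHolder w p := by
  rw [← EReal.coe_zero] at h
  obtain ⟨δ, A, -, hδ, hA, h⟩ := exists_phiDecay_of_lt_ind hw h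
  -- The exponent p is determined by 1 - 1/p = c < δ; 0 < c < 1 makes p finite and larger than 1.
  obtain ⟨c, hc0, hc⟩ := exists_between (lt_min hδ one_pos)
  have h1 : c < 1 := hc.trans_le (min_le_right _ _)
  refine ⟨1 / (1 - c), ?_, h.reverseHolder hw hA ?_ ?_⟩
  · rw [lt_one_div one_pos (by linarith)]
    linarith
  · rw [lt_one_div one_pos (by linarith)]
    linarith
  · rw [one_div_one_div, sub_sub_cancel]
    exact hc.trans_le (min_le_left _ _)

end ReverseHolder

end

section

variable {n : ℕ} {w : (Fin n → ℝ) → ℝ}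

/-! ### Gehring's lemma -/

section Gehring

theorem IsWeight.setIntegral_le_rpow (hw : IsWeight w) {p : ℝ} (hp : 1 < p) {Q : Cube n}
    (hi : IntegrableOn (fun x => w x ^ p) Q.toSet) {E : Set (Fin n → ℝ)} (hEQ : E ⊆ Q.toSet) :
    ∫ x in E, w x ≤ (∫ x in E, w x ^ p) ^ (1 / p) * volume.real E ^ (1 - 1 / p) := by
  have hp0 : 0 < p := by linarith
  have hpq : p.HolderConjugate (Real.conjExponent p) := Real.HolderConjugate.conjExponent hp
  have hfin : IsFiniteMeasure (volume.restrict E) :=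
    isFiniteMeasure_of_le _ (Measure.restrict_mono_set _ hEQ)
  have hm : MemLp w (ENNReal.ofReal p) (volume.restrict E) := by
    rw [← integrable_norm_rpow_iff hw.1.aestronglyMeasurable.restrict (by simpa using hp0)
      ENNReal.ofReal_ne_top, ENNReal.toReal_ofReal hp0.le]
    refine (hi.mono_set hEQ).congr ?_
    filter_upwards [hw.ae_pos E] with x hx
    rw [Real.norm_of_nonneg hx.le]
  have h := integral_mul_le_Lp_mul_Lq_of_nonneg hpq (hw.ae_nonneg E)
    (Filter.Eventually.of_forall fun _ => zero_le_one) hm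
    (memLp_const (1 : ℝ) (p := ENNReal.ofReal (Real.conjExponent p)) (μ := volume.restrict E))
  simp only [mul_one, Real.one_rpow] at h
  rw [setIntegral_const, smul_eq_mul, mul_one] at h
  have e : 1 - 1 / p = (Real.conjExponent p)⁻¹ := by rw [one_div]; exact hpq.one_sub_inv
  rw [e]
  simpa only [one_div] using h

theorem ReverseHolder.isWeight_rpow (hw : IsWeight w) {p : ℝ} (h : ReverseHolder w p) :
    IsWeight fun x => w x ^ p := by
  obtain ⟨C, -, h⟩ := h
  refine ⟨fun x => ?_, hw.2.mono fun x hx => Real.rpow_pos_of_pos hx p⟩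
  let Q : Cube n := ⟨fun i => x i - 1, 2, two_pos⟩
  refine ⟨Q.toSet, ?_, (h Q).1⟩
  have e : Q.toSet = Metric.closedBall x 1 := by
    rw [Q.toSet_eq_closedBall]
    congr 1
    · funext i
      simp only [Q]
      ring
    · norm_num [Q]
  rw [e]
  exact Metric.closedBall_mem_nhds x one_pos

/-- By Hölder and RH_p, a set E with |E| ≤ ε|Q| carries at most half of w(Q). The complement carries
the other half, and Hölder on the complement turns this into a lower bound for its w^p-mass. -/
theorem ReverseHolder.smallPortions_rpow (hw : IsWeight w) {p : ℝ} (hp : 1 < p)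
    (h : ReverseHolder w p) : SmallPortions fun x => w x ^ p := by
  have hv := h.isWeight_rpow hw
  obtain ⟨C, hC, h⟩ := h
  have hp0 : 0 < p := by linarith
  have hp1 : 0 < 1 - 1 / p := by
    rw [sub_pos, div_lt_one hp0]
    exact hp
  set B := C ^ (1 / p) with hB
  have hB0 : 0 < B := by positivity
  -- Solves B ε^(1-1/p) = 1/2, so that E carries at most half of the mass in `hE1`.
  set ε := (1 / (2 * B)) ^ (1 / (1 - 1 / p)) with hε
  have hε0 : 0 < ε := by positivity
  have hεB : ε ^ (1 - 1 / p) = 1 / (2 * B) := by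
    rw [hε, ← Real.rpow_mul (by positivity), one_div_mul_cancel hp1.ne', Real.rpow_one]
  -- The first entry is the share of V left off E by `h5`; the second only ensures η < 1.
  set η := min (1 / (2 * B) ^ p) (1 / 2) with hη
  have hη0 : 0 < η := lt_min (by positivity) (by norm_num)
  have hη1 : η ≤ 1 / (2 * B) ^ p := min_le_left _ _
  refine ⟨ε, η, hε0, hη0, (min_le_right _ _).trans_lt (by norm_num), ?_⟩
  intro Q E hEQ hEm hE
  have hQ := Q.vol_pos
  have hW := hw.setIntegral_pos Q
  obtain ⟨hi, hQp⟩ := h Q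
  set W := ∫ x in Q.toSet, w x with hWd
  set V := ∫ x in Q.toSet, w x ^ p with hVd
  set V' := ∫ x in Q.toSet \ E, w x ^ p with hV'd
  set m := Q.vol ^ (1 - 1 / p) with hm
  have hm0 : 0 < m := by positivity
  have hV0 : 0 ≤ V := hv.setIntegral_nonneg _
  have hV'0 : 0 ≤ V' := hv.setIntegral_nonneg _
  have hsplit : W = (∫ x in E, w x) + ∫ x in Q.toSet \ E, w x := by
    have := integral_inter_add_sdiff hEm (hw.integrableOn Q)
    rw [Set.inter_eq_self_of_subset_right hEQ] at this
    exact this.symm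
  have hsplitV : V = (∫ x in E, w x ^ p) + V' := by
    have := integral_inter_add_sdiff hEm hi
    rw [Set.inter_eq_self_of_subset_right hEQ] at this
    exact this.symm
  have hVW : V ^ (1 / p) * m ≤ B * W := by
    have h1 : V ^ (1 / p) ≤ (C * (Q.vol * (W / Q.vol) ^ p)) ^ (1 / p) :=
      Real.rpow_le_rpow hV0 hQp (by positivity)
    have h2 : (C * (Q.vol * (W / Q.vol) ^ p)) ^ (1 / p) = B * (Q.vol ^ (1 / p) * (W / Q.vol)) := by
      rw [Real.mul_rpow hC.le (by positivity), Real.mul_rpow hQ.le (by positivity),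
        ← Real.rpow_mul (by positivity), mul_one_div_cancel hp0.ne', Real.rpow_one]
    have h3 : Q.vol ^ (1 / p) * m = Q.vol := by
      rw [hm, ← Real.rpow_add hQ, add_sub_cancel, Real.rpow_one]
    calc V ^ (1 / p) * m ≤ B * (Q.vol ^ (1 / p) * (W / Q.vol)) * m := by
          gcongr
          exact h1.trans h2.le
      _ = B * (Q.vol ^ (1 / p) * m * (W / Q.vol)) := by ring
      _ = B * W := by rw [h3, mul_div_cancel₀ _ hQ.ne']
  have hE1 : ∫ x in E, w x ≤ 1 / 2 * W := by
    calc ∫ x in E, w x ≤ (∫ x in E, w x ^ p) ^ (1 / p) * volume.real E ^ (1 - 1 / p) :=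
          hw.setIntegral_le_rpow hp hi hEQ
      _ ≤ V ^ (1 / p) * (ε * Q.vol) ^ (1 - 1 / p) := by
          have := hv.setIntegral_nonneg E
          gcongr
          exact hv.setIntegral_mono hEQ subset_rfl
      _ = V ^ (1 / p) * m * (1 / (2 * B)) := by
          rw [Real.mul_rpow hε0.le hQ.le, hεB]
          ring
      _ ≤ B * W * (1 / (2 * B)) := by gcongr
      _ = 1 / 2 * W := by field_simp
  have hE2 : ∫ x in Q.toSet \ E, w x ≤ V' ^ (1 / p) * m := by
    refine (hw.setIntegral_le_rpow hp hi Set.sdiff_subset).trans ?_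
    gcongr ?_ * ?_
    exact Real.rpow_le_rpow measureReal_nonneg (Cube.measureReal_le_vol Set.sdiff_subset) hp1.le
  have h4 : V ^ (1 / p) ≤ 2 * B * V' ^ (1 / p) := by
    refine le_of_mul_le_mul_right ?_ hm0
    have : B * W ≤ B * (2 * (V' ^ (1 / p) * m)) := by
      gcongr
      linarith
    linarith
  have h5 : V ≤ (2 * B) ^ p * V' := by
    have := Real.rpow_le_rpow (by positivity) h4 hp0.le
    rwa [Real.mul_rpow (by positivity) (by positivity), ← Real.rpow_mul hV0, ← Real.rpow_mul hV'0,
      one_div_mul_cancel hp0.ne', Real.rpow_one, Real.rpow_one] at this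
  have h6 : η * V ≤ V' := by
    calc η * V ≤ 1 / (2 * B) ^ p * ((2 * B) ^ p * V') := by gcongr
      _ = V' := by field_simp
  change ∫ x in E, w x ^ p ≤ (1 - η) * V
  linarith

/-- Gehring's lemma. -/
theorem ReverseHolder.exists_gt (hw : IsWeight w) {p : ℝ} (hp : 1 < p) (h : ReverseHolder w p) :
    ∃ q, p < q ∧ ReverseHolder w q := by
  have hv := h.isWeight_rpow hw
  have hp0 : 0 < p := by linarith
  obtain ⟨δ, C, hδ, hC, hg⟩ := (h.smallPortions_rpow hw hp).exists_phiGrowth hv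
  -- RH_r for w^p bounds averages of w^(pr) by those of w^p, and RH_p for w bounds the latter by
  -- averages of w.
  obtain ⟨r, hr, C', hC', h'⟩ := exists_reverseHolder_of_zero_lt_ind hv
    (by exact_mod_cast hg.lt_ind hC hδ.le hδ)
  obtain ⟨C, hC, h⟩ := h
  refine ⟨p * r, lt_mul_of_one_lt_right hp0 hr, C' * C ^ r, by positivity, fun Q => ?_⟩
  have hQ := Q.vol_pos
  have hW := hw.setIntegral_pos Q
  have hV := hv.setIntegral_nonneg Q.toSet
  have he : (fun x => (w x ^ p) ^ r) =ᵐ[volume.restrict Q.toSet] fun x => w x ^ (p * r) := by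
    filter_upwards [hw.ae_pos Q.toSet] with x hx
    rw [Real.rpow_mul hx.le]
  refine ⟨(h' Q).1.congr he, ?_⟩
  rw [← integral_congr_ae he]
  refine (h' Q).2.trans ?_
  rw [Real.rpow_mul (by positivity), mul_assoc C', mul_left_comm (C ^ r),
    ← Real.mul_rpow hC.le (by positivity)]
  gcongr
  rw [div_le_iff₀ hQ]
  refine (h Q).2.trans (le_of_eq ?_)
  ring

end Gehring

/-! ### The class RH_{L log L} -/

section LLogL

/-- Uses log y ≤ y^(p-1)/(p-1) for y = e + x, which is at most twice the larger of e and x. -/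
theorem mul_log_exp_add_le {p x : ℝ} (hp : 1 < p) (hx : 0 ≤ x) :
    x * Real.log (Real.exp 1 + x) ≤
      (2 * Real.exp 1) ^ (p - 1) / (p - 1) * x + 2 ^ (p - 1) / (p - 1) * x ^ p := by
  have hp1 : 0 < p - 1 := by linarith
  have he := Real.exp_pos 1
  have h1 : Real.log (Real.exp 1 + x) ≤ (Real.exp 1 + x) ^ (p - 1) / (p - 1) :=
    Real.log_le_rpow_div (by positivity) hp1
  have h2 : (Real.exp 1 + x) ^ (p - 1) ≤ (2 * Real.exp 1) ^ (p - 1) + (2 * x) ^ (p - 1) := by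
    rcases le_total x (Real.exp 1) with h | h
    · refine (Real.rpow_le_rpow (by positivity) (by linarith) hp1.le).trans
        (le_add_of_nonneg_right (by positivity))
    · refine (Real.rpow_le_rpow (by positivity) (by linarith) hp1.le).trans
        (le_add_of_nonneg_left (by positivity))
  have h3 : x * x ^ (p - 1) = x ^ p := by
    rcases hx.eq_or_lt with rfl | hx
    · rw [zero_mul, Real.zero_rpow (by linarith)]
    · rw [← Real.rpow_one_add' hx.le (by linarith), add_sub_cancel]
  calc x * Real.log (Real.exp 1 + x)
      ≤ x * (((2 * Real.exp 1) ^ (p - 1) + (2 * x) ^ (p - 1)) / (p - 1)) := by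
        gcongr
        exact h1.trans (by gcongr)
    _ = (2 * Real.exp 1) ^ (p - 1) / (p - 1) * x + 2 ^ (p - 1) / (p - 1) * (x * x ^ (p - 1)) := by
        rw [Real.mul_rpow zero_le_two hx]
        ring
    _ = _ := by rw [h3]

theorem ReverseHolder.mem_RHLLogL (hw : IsWeight w) {p : ℝ} (hp : 1 < p)
    (h : ReverseHolder w p) : w ∈ RHLLogL n := by
  obtain ⟨C, hC, h⟩ := h
  have hp1 : 0 < p - 1 := by linarith
  set A := (2 * Real.exp 1) ^ (p - 1) / (p - 1) with hA
  set B := 2 ^ (p - 1) / (p - 1) with hB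
  have hA0 : 0 < A := by positivity
  have hB0 : 0 < B := by positivity
  -- Makes A/K + BC/K ≤ 1, while K ≥ 1 allows K^p to be replaced by K in the second term.
  set K := 1 + A + B * C with hK
  have hK1 : 1 ≤ K := by
    have : 0 < B * C := by positivity
    linarith
  have hK0 : 0 < K := by linarith
  refine ⟨hw, K, hK0, fun Q => ?_⟩
  have hQ := Q.vol_pos
  have hW := hw.setIntegral_pos Q
  obtain ⟨hi, hQp⟩ := h Q
  rw [hw.avg_eq, ← ENNReal.ofReal_mul hK0.le]
  set a := (∫ x in Q.toSet, w x) / Q.vol with ha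
  have ha0 : 0 < a := by positivity
  have hr : 0 < K * a := by positivity
  refine sInf_le ⟨K * a, hr, rfl, ?_⟩
  rw [← ENNReal.ofReal_one, Cube.avg_le_ofReal_iff, one_mul]
  have hi1 : IntegrableOn (fun x => A / (K * a) * w x) Q.toSet := (hw.integrableOn Q).const_mul _
  have hi2 : IntegrableOn (fun x => B / (K * a) ^ p * w x ^ p) Q.toSet := hi.const_mul _
  have hle : ∫⁻ x in Q.toSet, ENNReal.ofReal
      (|w x| / (K * a) * Real.log (Real.exp 1 + |w x| / (K * a))) ≤
      ∫⁻ x in Q.toSet, ENNReal.ofReal (A / (K * a) * w x + B / (K * a) ^ p * w x ^ p) := by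
    refine lintegral_mono_ae ?_
    filter_upwards [hw.ae_pos Q.toSet] with x hx
    refine ENNReal.ofReal_le_ofReal ?_
    rw [abs_of_pos hx]
    refine (mul_log_exp_add_le hp (by positivity)).trans (le_of_eq ?_)
    rw [Real.div_rpow hx.le hr.le]
    ring
  refine hle.trans ?_
  rw [← ofReal_integral_eq_lintegral_ofReal
    (f := fun x => A / (K * a) * w x + B / (K * a) ^ p * w x ^ p) (hi1.add hi2) ?_]
  · refine ENNReal.ofReal_le_ofReal ?_
    rw [integral_add hi1 hi2, integral_const_mul, integral_const_mul]
    have e1 : A / (K * a) * ∫ x in Q.toSet, w x = A / K * Q.vol := by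
      rw [ha]
      field_simp
    have e2 : B / (K * a) ^ p * ∫ x in Q.toSet, w x ^ p ≤ B * C / K * Q.vol := by
      calc B / (K * a) ^ p * ∫ x in Q.toSet, w x ^ p
          ≤ B / (K * a) ^ p * (C * (Q.vol * a ^ p)) := by gcongr
        _ = B * C / K ^ p * Q.vol := by
          rw [Real.mul_rpow hK0.le ha0.le]
          field_simp
        _ ≤ B * C / K * Q.vol := by
          gcongr
          exact Real.self_le_rpow_of_one_le hK1 hp.le
    have e3 : (A / K + B * C / K) * Q.vol ≤ Q.vol := by
      refine mul_le_of_le_one_left hQ.le ?_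
      rw [← add_div, div_le_one hK0]
      linarith
    linarith
  · filter_upwards [hw.ae_pos Q.toSet] with x hx
    exact add_nonneg (by positivity) (by positivity)

/-- On E either w ≤ M r, or the logarithm is at least 8C and w is at most r/(8C) times the L log L
integrand. Each part contributes at most r|Q|/(8C), which is at most w(Q)/4 because r is less than
2C times the average. -/
theorem smallPortions_of_mem_RHLLogL (h : w ∈ RHLLogL n) : SmallPortions w := by
  obtain ⟨hw, C, hC, h⟩ := h
  set M := Real.exp (8 * C) with hM
  have hM0 : 0 < M := Real.exp_pos _
  refine ⟨1 / (8 * C * M), 1 / 2, by positivity, by norm_num, by norm_num, ?_⟩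
  intro Q E hEQ hEm hE
  have hQ := Q.vol_pos
  have hW := hw.setIntegral_pos Q
  -- Doubling C makes the inequality strict, so an admissible r exists below the bound without the
  -- infimum being attained.
  have hlt : normLLogL w Q < ENNReal.ofReal (2 * C * ((∫ x in Q.toSet, w x) / Q.vol)) := by
    refine (h Q).trans_lt ?_
    rw [hw.avg_eq, ← ENNReal.ofReal_mul hC.le, ENNReal.ofReal_lt_ofReal_iff (by positivity)]
    have : 0 < C * ((∫ x in Q.toSet, w x) / Q.vol) := by positivity
    linarith
  obtain ⟨R, ⟨r, hr, rfl, hr1⟩, hrlt⟩ := sInf_lt_iff.1 hlt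
  rw [ENNReal.ofReal_lt_ofReal_iff (by positivity)] at hrlt
  rw [← ENNReal.ofReal_one, Cube.avg_le_ofReal_iff, one_mul] at hr1
  set G : (Fin n → ℝ) → ℝ := fun x => |w x| / r * Real.log (Real.exp 1 + |w x| / r) with hG
  have hlog : ∀ y : ℝ, 0 ≤ y → 0 ≤ Real.log (Real.exp 1 + y) := fun y hy =>
    Real.log_nonneg (by linarith [Real.add_one_le_exp 1])
  have hG0 : ∀ x, 0 ≤ G x := fun x =>
    mul_nonneg (by positivity) (hlog _ (by positivity))
  have hGm : AEStronglyMeasurable G (volume.restrict Q.toSet) := by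
    have hm : AEMeasurable w (volume.restrict Q.toSet) :=
      (hw.integrableOn Q).aestronglyMeasurable.aemeasurable
    have ha : AEMeasurable (fun x => |w x| / r) (volume.restrict Q.toSet) :=
      (measurable_norm.comp_aemeasurable hm).div_const r
    exact (ha.mul (Real.measurable_log.comp_aemeasurable (ha.const_add _))).aestronglyMeasurable
  obtain ⟨hGi, hGQ⟩ := (lintegral_ofReal_le_iff hGm (Filter.Eventually.of_forall hG0) hQ.le).1 hr1
  have hfin : IsFiniteMeasure (volume.restrict E) :=
    isFiniteMeasure_of_le _ (Measure.restrict_mono_set _ hEQ)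
  have hGE : IntegrableOn G E := IntegrableOn.mono_set hGi hEQ
  have hbound : ∫ x in E, w x ≤ ∫ x in E, (M * r + r / (8 * C) * G x) := by
    refine integral_mono_ae ((hw.integrableOn Q).mono_set hEQ)
      ((integrable_const _).add (hGE.const_mul _)) ?_
    filter_upwards [hw.ae_pos E] with x hx
    rcases le_total (w x) (M * r) with hle | hge
    · have : 0 ≤ r / (8 * C) * G x := mul_nonneg (by positivity) (hG0 x)
      linarith
    · have h1 : 8 * C ≤ Real.log (Real.exp 1 + |w x| / r) := by
        rw [Real.le_log_iff_exp_le (by positivity), abs_of_pos hx]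
        have : M ≤ w x / r := (le_div_iff₀ hr).2 hge
        have := Real.exp_pos 1
        linarith
      have h2 : w x ≤ r / (8 * C) * G x := by
        calc w x = r / (8 * C) * (|w x| / r * (8 * C)) := by
              rw [abs_of_pos hx]
              field_simp
          _ ≤ r / (8 * C) * G x := by
              simp only [hG]
              gcongr
      have : 0 < M * r := by positivity
      linarith
  rw [integral_add (integrable_const _) (hGE.const_mul _), setIntegral_const, smul_eq_mul,
    integral_const_mul] at hbound
  have hGE' : ∫ x in E, G x ≤ Q.vol :=
    (setIntegral_mono_set hGi (Filter.Eventually.of_forall hG0) hEQ.eventuallyLE).trans hGQ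
  have h1 : volume.real E * (M * r) ≤ r / (8 * C) * Q.vol := by
    calc volume.real E * (M * r) ≤ 1 / (8 * C * M) * Q.vol * (M * r) := by gcongr
      _ = _ := by field_simp
  have h2 : r / (8 * C) * ∫ x in E, G x ≤ r / (8 * C) * Q.vol := by gcongr
  have h3 : r / (8 * C) * Q.vol ≤ 1 / 4 * ∫ x in Q.toSet, w x := by
    calc r / (8 * C) * Q.vol
        ≤ 2 * C * ((∫ x in Q.toSet, w x) / Q.vol) / (8 * C) * Q.vol := by gcongr
      _ = _ := by
        field_simp
        ring
  linarith

end LLogL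

/-! ### Assembling the characterisations -/

theorem one_div_conjExponent {p : ℝ} (hp : 1 < p) : 1 / Real.conjExponent p = 1 - 1 / p := by
  rw [one_div, one_div]
  exact (Real.HolderConjugate.conjExponent hp).one_sub_inv.symm

/-- The growth exponent from RH_p is exactly 1 - 1/p; the strict inequality comes from the larger
exponent in Gehring's lemma. -/
theorem ReverseHolder.lt_ind_self (hw : IsWeight w) {p : ℝ} (hp : 1 < p)
    (h : ReverseHolder w p) : ((1 - 1 / p : ℝ) : EReal) < ind (phi (n := n) w) := by
  obtain ⟨q, hpq, hq⟩ := h.exists_gt hw hp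
  refine hq.lt_ind hw (hp.trans hpq) ?_
  have := one_div_lt_one_div_of_lt (by linarith : 0 < p) hpq
  linarith

theorem mem_RH_iff : w ∈ RH n ↔ IsWeight w ∧ ∃ p, 1 < p ∧ ReverseHolder w p := by
  simp only [RH, Set.mem_iUnion, Set.mem_Ioi, exists_prop]
  constructor
  · rintro ⟨p, hp, h⟩
    exact ⟨h.1, p, hp, ((mem_RHp_iff hp).1 h).2⟩
  · rintro ⟨hw, p, hp, h⟩
    exact ⟨p, hp, (mem_RHp_iff hp).2 ⟨hw, h⟩⟩

end

end RevHolder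

end

theorem mainTheorem1 (n : ℕ) (hn : 1 ≤ n) :
    (∀ p : ℝ, 1 < p →
      RevHolder.RHp n p =
          {w | RevHolder.IsWeight w ∧
            0 < RevHolder.ind (RevHolder.phiParam (n := n) w (1 / Real.conjExponent p) p)} ∧
      RevHolder.RHp n p =
          {w | RevHolder.IsWeight w ∧
            ((1 / Real.conjExponent p : ℝ) : EReal) <
              RevHolder.ind (RevHolder.phi (n := n) w)}) ∧
    RevHolder.RH n =
        {w | RevHolder.IsWeight w ∧ 0 < RevHolder.ind (RevHolder.phi (n := n) w)} ∧
    RevHolder.RH n = RevHolder.RHLLogL n := by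
  have key : ∀ p : ℝ, 1 < p → RevHolder.RHp n p =
      {w | RevHolder.IsWeight w ∧ ((1 / Real.conjExponent p : ℝ) : EReal) <
        RevHolder.ind (RevHolder.phi (n := n) w)} := by
    intro p hp
    ext w
    rw [RevHolder.mem_RHp_iff hp, RevHolder.one_div_conjExponent hp]
    exact and_congr_right fun hw =>
      ⟨fun h => h.lt_ind_self hw hp, RevHolder.reverseHolder_of_lt_ind hw hp⟩
  refine ⟨fun p hp => ⟨?_, key p hp⟩, ?_, ?_⟩
  · rw [key p hp]
    ext w
    refine and_congr_right fun _ => (RevHolder.zero_lt_ind_phiParam_iff ?_ (by linarith)).symm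
    rw [RevHolder.one_div_conjExponent hp, sub_nonneg, div_le_one (by linarith)]
    exact hp.le
  · ext w
    rw [RevHolder.mem_RH_iff]
    refine and_congr_right fun hw =>
      ⟨?_, RevHolder.exists_reverseHolder_of_zero_lt_ind hw⟩
    rintro ⟨p, hp, h⟩
    refine lt_of_le_of_lt ?_ (h.lt_ind_self hw hp)
    rw [← EReal.coe_zero, EReal.coe_le_coe_iff, sub_nonneg, div_le_one (by linarith)]
    exact hp.le
  · ext w
    rw [RevHolder.mem_RH_iff]
    constructor
    · rintro ⟨hw, p, hp, h⟩
      exact h.mem_RHLLogL hw hp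
    · intro h
      have hw := h.1
      obtain ⟨δ, C, hδ, hC, hg⟩ :=
        (RevHolder.smallPortions_of_mem_RHLLogL h).exists_phiGrowth hw
      exact ⟨hw, RevHolder.exists_reverseHolder_of_zero_lt_ind hw
        (by exact_mod_cast hg.lt_ind hC hδ.le hδ)⟩
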